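/- Let $d\ge 0$ be an integer, $\alpha>-1/2$, $\mathbb R^{d+1}_+=\mathbb R^d\times(0,\infty)$, $x=(x',x_{d+1})$ and $-x:=(-x',x_{d+1})$. Put $$d\mu_\alpha(x)=\frac{x_{d+1}^{2\alpha+1}}{(2\pi)^{d/2}\,2^{\alpha}\,\Gamma(\alpha+1)}\,dx,\qquad L^p_\alpha=L^p(\mathbb R^{d+1}_+,\mu_\alpha;\mathbb C),\qquad \Lambda(\lambda,x)=e^{-i\langle x',\lambda'\rangle}j_\alpha(x_{d+1}\lambda_{d+1}),$$ where $j_\alpha(t)=\Gamma(\alpha+1)\sum_{k\ge0}\frac{(-1)^k(t/2)^{2k}}{k!\,\Gamma(\alpha+k+1)}$, and write $\|\cdot\|_{\alpha,2}$ for the norm of $L^2_\alpha$. The Weinstein transform is $\mathcal F\varphi(\lambda)=\int\varphi(x)\Lambda(\lambda,x)\,d\mu_\alpha(x)$ for $\varphi\in L^1_\alpha$, extended from $L^1_\alpha\cap L^2_\alpha$ to an isometric isomorphism of $L^2_\alpha$. Its inverse $\mathcal F^{-1}$ is given by $\mathcal F^{-1}g(\lambda)=\mathcal Fg(-\lambda)$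 for $g\in L^1_\alpha$, and by the inverse isometry for $g\in L^2_\alpha$. The generalized translation and convolution are $$\tau_x\varphi(y)=\frac{\Gamma(\alpha+1)}{\sqrt\pi\,\Gamma(\alpha+\frac12)}\int_0^\pi\varphi\Big(x'+y',\sqrt{x_{d+1}^2+y_{d+1}^2+2x_{d+1}y_{d+1}\cos\theta}\Big)(\sin\theta)^{2\alpha}\,d\theta,$$ $$(\varphi*_W\psi)(x)=\int\tau_x\varphi(-y)\,\psi(y)\,d\mu_\alpha(y).$$ For $m\in L^2_\alpha$ and $\sigma>0$ put $m_\sigma(x)=m(\sigma x)$ and $\mathcal T_{w,m,\sigma}\varphi=\mathcal F^{-1}(m_\sigma\,\mathcal F\varphi)$. **Theorem.** Let $m\in L^2_\alpha$ satisfy the admissibility condition $$\int_0^\infty|m(\sigma x)|^2\,\frac{d\sigma}{\sigma}=1\qquad\text{for almost every }x\in\mathbb R^{d+1}_+.$$ (i) (Plancherel formula) For every $\varphi\in L^2_\alpha$, $$\int_{\mathbb R^{d+1}_+}|\varphi(x)|^2\,d\mu_\alpha(x)=\int_0^\infty\|\mathcal T_{w,m,\sigma}\varphi\|_{\alpha,2}^2\,\frac{d\sigma}{\sigma},$$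 where $\|\mathcal T_{w,m,\sigma}\varphi\|_{\alpha,2}\in[0,\infty]$. (ii) (First Calderón formula) If $\varphi\in L^1_\alpha$ and $\mathcal F\varphi\in L^1_\alpha$, then for almost every $x\in\mathbb R^{d+1}_+$ the integral defining $\big(\mathcal T_{w,m,\sigma}\varphi*_W\mathcal F^{-1}(\overline{m_\sigma})\big)(x)$ converges absolutely for every $\sigma>0$, this function of $\sigma$ is integrable with respect to $d\sigma/\sigma$ on $(0,\infty)$, and $$\varphi(x)=\int_0^\infty\big(\mathcal T_{w,m,\sigma}\varphi*_W\mathcal F^{-1}(\overline{m_\sigma})\big)(x)\,\frac{d\sigma}{\sigma}.$$ -/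

import Mathlib

open MeasureTheory
open scoped ENNReal ComplexConjugate

noncomputable section

namespace Weinstein

/-- The ambient space `ℝ^d × ℝ`; a point is `x = (x', x_{d+1})`. The half-space
`ℝ^d × (0, ∞)` enters through the measure below, which is carried by it. -/
abbrev Pt (d : ℕ) : Type := EuclideanSpace ℝ (Fin d) × ℝ

/-- The open half-space `ℝ^d × (0, ∞)`. -/
def halfSpace (d : ℕ) : Set (Pt d) := {x | 0 < x.2}

/-- The weighted measure
`x_{d+1}^{2α+1} / ((2π)^{d/2} 2^α Γ(α+1)) dx` on the half-space `ℝ^d × (0, ∞)`, normalized so that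
the transform below is an isometry of `L²`. -/
def mu (d : ℕ) (α : ℝ) : Measure (Pt d) :=
  (volume.restrict (halfSpace d)).withDensity fun x =>
    ENNReal.ofReal (x.2 ^ (2 * α + 1) /
      ((2 * Real.pi) ^ ((d : ℝ) / 2) * 2 ^ α * Real.Gamma (α + 1)))

/-- The measure `dσ/σ` on `(0, ∞)`. -/
def scaleMeasure : Measure ℝ :=
  (volume.restrict (Set.Ioi 0)).withDensity fun σ => ENNReal.ofReal (1 / σ)

/-- The reflection `-x = (-x', x_{d+1})`. -/
def refl {d : ℕ} (x : Pt d) : Pt d := (-x.1, x.2)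

/-- The normalized Bessel function
`j_α(t) = Γ(α+1) ∑_k (-1)^k (t/2)^{2k} / (k! Γ(α+k+1))`. -/
def besselJ (α t : ℝ) : ℝ :=
  Real.Gamma (α + 1) *
    ∑' k : ℕ, (-1) ^ k * (t / 2) ^ (2 * k) / ((k.factorial : ℝ) * Real.Gamma (α + k + 1))

/-- The Weinstein kernel `Λ(l, x) = exp(-i⟨x', l'⟩) j_α(x_{d+1} l_{d+1})`. -/
def kernel {d : ℕ} (α : ℝ) (l x : Pt d) : ℂ :=
  Complex.exp (-Complex.I * ((inner ℝ x.1 l.1 : ℝ) : ℂ)) * (besselJ α (x.2 * l.2) : ℂ)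

/-- The Weinstein transform of an integrable function, as an absolutely convergent integral. -/
def transformL1 {d : ℕ} (α : ℝ) (φ : Pt d → ℂ) (l : Pt d) : ℂ :=
  ∫ x, φ x * kernel α l x ∂(mu d α)

/-- `U` is an isometric isomorphism of `L²` which agrees with the integral transform
on `L¹ ∩ L²`. As `L¹ ∩ L²` is dense in `L²`, there is at most one such `U`. -/
def IsPlancherelExtension (d : ℕ) (α : ℝ)
    (U : Lp ℂ 2 (mu d α) ≃ₗᵢ[ℂ] Lp ℂ 2 (mu d α)) : Prop :=
  ∀ (φ : Pt d → ℂ) (_ : MemLp φ 1 (mu d α)) (h2 : MemLp φ 2 (mu d α)),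
    ⇑(U (h2.toLp φ)) =ᵐ[mu d α] transformL1 α φ

instance nonempty_isometryEquiv (d : ℕ) (α : ℝ) :
    Nonempty (Lp ℂ 2 (mu d α) ≃ₗᵢ[ℂ] Lp ℂ 2 (mu d α)) :=
  ⟨LinearIsometryEquiv.refl ℂ _⟩

/-- The Weinstein transform on `L²`: the isometric isomorphism of `L²` extending the integral
transform from `L¹ ∩ L²`. -/
def plancherel (d : ℕ) (α : ℝ) : Lp ℂ 2 (mu d α) ≃ₗᵢ[ℂ] Lp ℂ 2 (mu d α) :=
  Classical.epsilon (IsPlancherelExtension d α)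

open Classical in
/-- The Weinstein transform of a function in `L¹` (the integral) or in `L²` (the extension);
on `L¹ ∩ L²` both prescriptions agree almost everywhere. -/
def transform {d : ℕ} (α : ℝ) (φ : Pt d → ℂ) : Pt d → ℂ :=
  if MemLp φ 1 (mu d α) then transformL1 α φ
  else if h : MemLp φ 2 (mu d α) then ⇑(plancherel d α (h.toLp φ))
  else 0

open Classical in
/-- The inverse Weinstein transform: `l ↦ (transform of g)(-l)`, as an integral, for `g` in `L¹`,
and the inverse of the isometric isomorphism of `L²` for `g` in `L²`. -/
def invTransform {d : ℕ} (α : ℝ) (g : Pt d → ℂ) : Pt d → ℂ :=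
  if MemLp g 1 (mu d α) then fun l => transformL1 α g (refl l)
  else if h : MemLp g 2 (mu d α) then ⇑((plancherel d α).symm (h.toLp g))
  else 0

/-- The generalized translation
`τ_x φ(y) = C_α ∫_0^π φ(x'+y', √(x_{d+1}² + y_{d+1}² + 2 x_{d+1} y_{d+1} cos θ)) (sin θ)^{2α} dθ`
with `C_α = Γ(α+1) / (√π Γ(α+1/2))`. -/
def translate {d : ℕ} (α : ℝ) (x : Pt d) (φ : Pt d → ℂ) (y : Pt d) : ℂ :=
  ((Real.Gamma (α + 1) / (Real.sqrt Real.pi * Real.Gamma (α + 1 / 2)) : ℝ) : ℂ) *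
    ∫ θ in (0 : ℝ)..Real.pi,
      φ (x.1 + y.1, Real.sqrt (x.2 ^ 2 + y.2 ^ 2 + 2 * x.2 * y.2 * Real.cos θ)) *
        ((Real.sin θ ^ (2 * α) : ℝ) : ℂ)

/-- The integral defining `(φ * ψ)(x)` converges absolutely. -/
def ConvExistsAt {d : ℕ} (α : ℝ) (φ ψ : Pt d → ℂ) (x : Pt d) : Prop :=
  Integrable (fun y => translate α x φ (refl y) * ψ y) (mu d α)

/-- The generalized convolution `(φ * ψ)(x) = ∫ τ_x φ(-y) ψ(y) dμ(y)`. -/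
def conv {d : ℕ} (α : ℝ) (φ ψ : Pt d → ℂ) (x : Pt d) : ℂ :=
  ∫ y, translate α x φ (refl y) * ψ y ∂(mu d α)

/-- The dilated symbol `m_σ(x) = m(σx)`. -/
def dilate {d : ℕ} (m : Pt d → ℂ) (σ : ℝ) (x : Pt d) : ℂ := m (σ • x)

/-- The multiplier operator `T_{m,σ} φ = F⁻¹(m_σ F φ)`. -/
def multiplier {d : ℕ} (α : ℝ) (m : Pt d → ℂ) (σ : ℝ) (φ : Pt d → ℂ) : Pt d → ℂ :=
  invTransform α fun x => dilate m σ x * transform α φ x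

/-- Admissibility: `∫_0^∞ |m(σx)|² dσ/σ = 1` for almost every `x` in the half-space. -/
def Admissible {d : ℕ} (α : ℝ) (m : Pt d → ℂ) : Prop :=
  ∀ᵐ x ∂(mu d α), ∫⁻ σ, ‖dilate m σ x‖ₑ ^ 2 ∂scaleMeasure = 1

end Weinstein

end

open MeasureTheory
open scoped ENNReal ComplexConjugate

noncomputable section

namespace Weinstein

/-! On the transform side $\mathcal T_{w,m,\sigma}$ is multiplication by $m_\sigma$, so both claims
come from integrating out $\sigma$ by Tonelli or Fubini, where admissibility turns
$\int|m(\sigma\lambda)|^2\,d\sigma/\sigma$ into $1$. For (i) this is Plancherel applied twice. For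
(ii), translation by $x$ multiplies the symbol by $\Lambda(-x,\cdot)$, so the $L^2$ multiplication
formula turns the convolution into $\int|m_\sigma|^2\,\mathcal
F\varphi\,\Lambda(-x,\cdot)\,d\mu_\alpha$; integrating over $\sigma$ leaves the inversion integral
of $\varphi$ at $x$.

The harmonic analysis is built from two explicit facts. The product formula
`integral_besselJ_mul_sqrt` says how translations act on the kernel; it is proved coefficientwise
from the moments of $\cos\theta$ and the Chu–Vandermonde identity. The formula `transformL1_gauss`
says that Gaussians go to Gaussians. Together they make the Gaussian multiplier an integral operator
with a positive kernel, which is an approximate identity (`tendsto_integral_heatKernel_mul`).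
Parseval against compactly supported functions follows, and by density the Plancherel isometry and
its surjectivity. Inversion for integrable transforms follows from Parseval and the multiplication
formula.

In (i) the product $m_\sigma\mathcal F\varphi$ is in $L^1$ but perhaps not in $L^2$;
`eLpNorm_transformL1` therefore proves Plancherel on $L^1$ with both sides possibly infinite. -/

/-! ### Rising factorials and the Chu–Vandermonde identity. -/

open Finset in
/-- The rising factorial `a (a + 1) ⋯ (a + k - 1)`. -/
def rising (a : ℝ) (k : ℕ) : ℝ := ∏ l ∈ range k, (a + l)

lemma rising_zero (a : ℝ) : rising a 0 = 1 := by simp [rising]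

lemma rising_succ (a : ℝ) (k : ℕ) : rising a (k + 1) = rising a k * (a + k) := by
  simp [rising, Finset.prod_range_succ]

lemma rising_add (a : ℝ) (k l : ℕ) : rising a (k + l) = rising a k * rising (a + k) l := by
  induction l with
  | zero => simp [rising_zero]
  | succ l ih => rw [← add_assoc, rising_succ, ih, rising_succ]; push_cast; ring

lemma rising_pos {a : ℝ} (ha : 0 < a) (k : ℕ) : 0 < rising a k :=
  Finset.prod_pos fun l _ => by positivity

lemma Gamma_add_nat {a : ℝ} (ha : 0 < a) (k : ℕ) :
    Real.Gamma (a + k) = rising a k * Real.Gamma a := by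
  induction k with
  | zero => simp [rising_zero]
  | succ k ih =>
    rw [rising_succ, Nat.cast_succ, ← add_assoc, Real.Gamma_add_one (by positivity), ih]
    ring

open Finset in
/-- The Chu–Vandermonde identity. -/
lemma chu_vandermonde (i : ℕ) : ∀ (n : ℕ) (a : ℝ),
    ∑ jl ∈ antidiagonal i, (i.choose jl.1 : ℝ) * ((n.descFactorial jl.1 : ℝ) *
      rising (a + jl.1) jl.2) = rising (a + n) i := by
  induction i with
  | zero => intro n a; simp [rising_zero]
  | succ i ih =>
    intro n a
    rw [sum_antidiagonal_choose_succ_mul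
      (fun j l => (n.descFactorial j : ℝ) * rising (a + j) l)]
    -- Pascal's rule has split the sum. In this half the extra factor is $a+j+l=a+i$, constant along
    -- the antidiagonal.
    have h1 : ∑ ij ∈ antidiagonal i, (i.choose ij.1 : ℝ) * ((n.descFactorial ij.1 : ℝ) *
        rising (a + ij.1) (ij.2 + 1)) = (a + i) * rising (a + n) i := by
      rw [← ih n a, mul_sum]
      refine sum_congr rfl fun jl h => ?_
      rw [rising_succ]
      have : (i : ℝ) = jl.1 + jl.2 := by
        rw [← mem_antidiagonal.1 h]; push_cast; ring
      rw [this]; ring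
    -- The other half is $n$ times the identity for $(n-1,a+1)$, which is why $n$ and $a$ vary in
    -- the induction.
    have h2 : ∑ ij ∈ antidiagonal i, (i.choose ij.2 : ℝ) *
        ((n.descFactorial (ij.1 + 1) : ℝ) * rising (a + ((ij.1 + 1 : ℕ) : ℝ)) ij.2) =
        n * rising (a + n) i := by
      rcases n with _ | n
      · simp
      · have := ih n (a + 1)
        rw [show a + ((n + 1 : ℕ) : ℝ) = a + 1 + n by push_cast; ring, ← this, mul_sum]
        refine sum_congr rfl fun jl h => ?_
        rw [Nat.succ_descFactorial_succ, Nat.choose_symm_of_eq_add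
          (show i = jl.2 + jl.1 by rw [← mem_antidiagonal.1 h]; ring)]
        push_cast
        rw [show a + (jl.1 + 1 : ℝ) = a + 1 + jl.1 by ring]
        ring
    rw [h1, h2, rising_succ]
    ring

/-! ### The angular probability measure. -/

/-- The normalizing constant `Γ(α+1) / (√π Γ(α+1/2))`. -/
def angleConst (α : ℝ) : ℝ :=
  Real.Gamma (α + 1) / (Real.sqrt Real.pi * Real.Gamma (α + 1 / 2))

lemma angleConst_pos {α : ℝ} (hα : -(1 / 2) < α) : 0 < angleConst α := by
  have h1 : 0 < Real.Gamma (α + 1) := Real.Gamma_pos_of_pos (by linarith)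
  have h2 : 0 < Real.Gamma (α + 1 / 2) := Real.Gamma_pos_of_pos (by linarith)
  have := Real.pi_pos
  unfold angleConst
  positivity

/-- The probability measure on `(0, π]` with density proportional to `(sin θ)^{2α}`. -/
def angleMeasure (α : ℝ) : Measure ℝ :=
  (volume.restrict (Set.Ioc 0 Real.pi)).withDensity fun θ =>
    ENNReal.ofReal (angleConst α * Real.sin θ ^ (2 * α))

lemma lintegral_rpow_mul_exp_neg_sq {s : ℝ} (hs : -1 < s) :
    ∫⁻ x in Set.Ioi (0 : ℝ), ENNReal.ofReal (x ^ s * Real.exp (-x ^ 2)) =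
      ENNReal.ofReal (Real.Gamma ((s + 1) / 2) / 2) := by
  have h := integral_rpow_mul_exp_neg_rpow (p := 2) (q := s) (by norm_num) hs
  have h2 := integrableOn_rpow_mul_exp_neg_rpow (s := s) (p := 2) hs (by norm_num)
  simp only [Real.rpow_two] at h h2
  rw [← ofReal_integral_eq_lintegral_ofReal h2, h]
  · congr 1; ring
  · filter_upwards [ae_restrict_mem measurableSet_Ioi] with x hx
    have : (0 : ℝ) < x := hx
    simp only [Pi.zero_apply]
    positivity

/-- Evaluate $\iint_{y>0}y^{2\alpha}e^{-x^2-y^2}\,dx\,dy$ in Cartesian and in polar coordinates: the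
angular factor is the integral sought, and all the others are Gamma values. -/
lemma lintegral_sin_rpow {α : ℝ} (hα : -(1 / 2) < α) :
    ∫⁻ θ in Set.Ioc 0 Real.pi, ENNReal.ofReal (Real.sin θ ^ (2 * α)) =
      ENNReal.ofReal (Real.sqrt Real.pi * Real.Gamma (α + 1 / 2) / Real.Gamma (α + 1)) := by
  have hG1 : 0 < Real.Gamma (α + 1) := Real.Gamma_pos_of_pos (by linarith)
  have hG2 : 0 < Real.Gamma (α + 1 / 2) := Real.Gamma_pos_of_pos (by linarith)
  let u : ℝ → ℝ≥0∞ := fun x => ENNReal.ofReal (Real.exp (-x ^ 2))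
  let v : ℝ → ℝ≥0∞ := (Set.Ioi 0).indicator
    fun y => ENNReal.ofReal (y ^ (2 * α) * Real.exp (-y ^ 2))
  have hu : Measurable u := by fun_prop
  have hv : Measurable v := (by fun_prop : Measurable _).indicator measurableSet_Ioi
  have hR : ∫⁻ p : ℝ × ℝ, u p.1 * v p.2 =
      ENNReal.ofReal (Real.sqrt Real.pi * Real.Gamma (α + 1 / 2) / 2) := by
    rw [Measure.volume_eq_prod, lintegral_prod_mul hu.aemeasurable hv.aemeasurable,
      lintegral_indicator measurableSet_Ioi, lintegral_rpow_mul_exp_neg_sq (by linarith),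
      ← ofReal_integral_eq_lintegral_ofReal, ← ENNReal.ofReal_mul]
    · have := integral_gaussian 1
      simp only [neg_one_mul, div_one] at this
      rw [this, show (2 * α + 1) / 2 = α + 1 / 2 by ring]
      congr 1; ring
    · exact integral_nonneg fun x => (Real.exp_pos _).le
    · simpa using integrable_exp_neg_mul_sq (b := 1) one_pos
    · exact Filter.Eventually.of_forall fun x => (Real.exp_pos _).le
  have hL : ∫⁻ p in polarCoord.target, ENNReal.ofReal p.1 •
      (fun q : ℝ × ℝ => u q.1 * v q.2) (polarCoord.symm p) =
      (∫⁻ r in Set.Ioi (0 : ℝ), ENNReal.ofReal (r ^ (2 * α + 1) * Real.exp (-r ^ 2))) *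
      ∫⁻ θ in Set.Ioo (-Real.pi) Real.pi, (Set.Ioo 0 Real.pi).indicator
        (fun θ => ENNReal.ofReal (Real.sin θ ^ (2 * α))) θ := by
    rw [← lintegral_prod_mul (by fun_prop)
      ((by fun_prop : Measurable _).indicator measurableSet_Ioo).aemeasurable,
      Measure.prod_restrict, ← Measure.volume_eq_prod]
    refine setLIntegral_congr_fun (measurableSet_Ioi.prod measurableSet_Ioo) fun p hp => ?_
    obtain ⟨hr, hθ1, hθ2⟩ : 0 < p.1 ∧ -Real.pi < p.2 ∧ p.2 < Real.pi := hp
    simp only [polarCoord_symm_apply, smul_eq_mul, u, v]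
    by_cases h : 0 < p.2
    · have hs := Real.sin_pos_of_pos_of_lt_pi h hθ2
      rw [Set.indicator_of_mem (show _ ∈ Set.Ioi (0:ℝ) from mul_pos hr hs),
        Set.indicator_of_mem (show p.2 ∈ Set.Ioo 0 Real.pi from ⟨h, hθ2⟩),
        ← ENNReal.ofReal_mul (by positivity), ← ENNReal.ofReal_mul (by positivity),
        ← ENNReal.ofReal_mul (by positivity)]
      congr 1
      rw [Real.mul_rpow hr.le hs.le, Real.rpow_add_one hr.ne']
      have : Real.exp (-p.1 ^ 2) =
          Real.exp (-(p.1 * Real.cos p.2) ^ 2) * Real.exp (-(p.1 * Real.sin p.2) ^ 2) := by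
        rw [← Real.exp_add]
        congr 1
        linear_combination (-p.1 ^ 2) * (-(Real.sin_sq_add_cos_sq p.2))
      rw [this]
      ring
    · have hs : Real.sin p.2 ≤ 0 :=
        Real.sin_nonpos_of_nonpos_of_neg_pi_le (not_lt.1 h) hθ1.le
      rw [Set.indicator_of_notMem (by
          simp only [Set.mem_Ioi, not_lt]; exact mul_nonpos_of_nonneg_of_nonpos hr.le hs),
        Set.indicator_of_notMem (by simp [h])]
      simp
  have key := hL.symm.trans ((lintegral_comp_polarCoord_symm _).trans hR)
  rw [lintegral_rpow_mul_exp_neg_sq (by linarith), setLIntegral_indicator measurableSet_Ioo,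
    Set.inter_eq_left.2 (Set.Ioo_subset_Ioo_left (by linarith [Real.pi_pos]))] at key
  rw [show (2 * α + 1 + 1) / 2 = α + 1 by ring] at key
  rw [← restrict_Ioo_eq_restrict_Ioc]
  have hne : ENNReal.ofReal (Real.Gamma (α + 1) / 2) ≠ 0 := by
    rw [Ne, ENNReal.ofReal_eq_zero, not_le]; positivity
  rw [← ENNReal.mul_right_inj hne ENNReal.ofReal_ne_top, key, ← ENNReal.ofReal_mul (by positivity)]
  congr 1
  field_simp

lemma isProbabilityMeasure_angleMeasure {α : ℝ} (hα : -(1 / 2) < α) :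
    IsProbabilityMeasure (angleMeasure α) := by
  constructor
  rw [angleMeasure, withDensity_apply _ MeasurableSet.univ, Measure.restrict_univ]
  simp_rw [ENNReal.ofReal_mul (angleConst_pos hα).le]
  rw [lintegral_const_mul _ (by fun_prop), lintegral_sin_rpow hα,
    ← ENNReal.ofReal_mul (angleConst_pos hα).le, ← ENNReal.ofReal_one]
  have hG1 : 0 < Real.Gamma (α + 1) := Real.Gamma_pos_of_pos (by linarith)
  have hG2 : 0 < Real.Gamma (α + 1 / 2) := Real.Gamma_pos_of_pos (by linarith)
  have := Real.pi_pos
  congr 1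
  unfold angleConst
  generalize Real.Gamma (α + 1 / 2) = g at hG2 ⊢
  field_simp

lemma integral_angleMeasure {E : Type*} [NormedAddCommGroup E] [NormedSpace ℝ E] {α : ℝ}
    (hα : -(1 / 2) < α) (f : ℝ → E) :
    ∫ θ, f θ ∂(angleMeasure α) =
      angleConst α • ∫ θ in (0 : ℝ)..Real.pi, (Real.sin θ ^ (2 * α)) • f θ := by
  rw [angleMeasure, integral_withDensity_eq_integral_toReal_smul (by fun_prop)
    (Filter.Eventually.of_forall fun _ => ENNReal.ofReal_lt_top),
    intervalIntegral.integral_of_le Real.pi_pos.le, ← integral_smul]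
  refine setIntegral_congr_fun measurableSet_Ioc fun θ hθ => ?_
  have hs : 0 ≤ Real.sin θ := Real.sin_nonneg_of_nonneg_of_le_pi hθ.1.le hθ.2
  rw [ENNReal.toReal_ofReal (mul_nonneg (angleConst_pos hα).le (Real.rpow_nonneg hs _)),
    mul_smul]

lemma intervalIntegrable_sin_rpow {α : ℝ} (hα : -(1 / 2) < α) :
    IntervalIntegrable (fun θ => Real.sin θ ^ (2 * α)) volume 0 Real.pi := by
  rw [intervalIntegrable_iff_integrableOn_Ioc_of_le Real.pi_pos.le]
  have h0 : ∀ᵐ θ ∂(volume.restrict (Set.Ioc 0 Real.pi)), 0 ≤ Real.sin θ ^ (2 * α) := by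
    filter_upwards [ae_restrict_mem measurableSet_Ioc] with θ hθ
    exact Real.rpow_nonneg (Real.sin_nonneg_of_nonneg_of_le_pi hθ.1.le hθ.2) _
  refine ⟨(Real.measurable_sin.pow_const _).aestronglyMeasurable, ?_⟩
  rw [hasFiniteIntegral_iff_ofReal h0, lintegral_sin_rpow hα]
  exact ENNReal.ofReal_lt_top

/-! ### Moments of the cosine. -/

/-- The moments of `cos θ`. -/
def cosMoment (α : ℝ) (k : ℕ) : ℝ := ∫ θ, Real.cos θ ^ k ∂(angleMeasure α)

lemma cosMoment_zero {α : ℝ} (hα : -(1 / 2) < α) : cosMoment α 0 = 1 := by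
  have := isProbabilityMeasure_angleMeasure hα
  simp [cosMoment]

/-- The derivative of $\cos^k\theta\,\sin^{2\alpha+1}\theta$ integrates to zero because
$2\alpha+1>0$. For $k=0$ the truncated index $k-1$ carries the factor $0$. -/
lemma cosMoment_succ {α : ℝ} (hα : -(1 / 2) < α) (k : ℕ) :
    (2 * α + 1 + k) * cosMoment α (k + 1) = k * cosMoment α (k - 1) := by
  have hI : ∀ n : ℕ, IntervalIntegrable
      (fun θ => Real.sin θ ^ (2 * α) * Real.cos θ ^ n) volume 0 Real.pi := fun n =>
    (intervalIntegrable_sin_rpow hα).mul_continuousOn (by fun_prop)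
  have h := intervalIntegral.integral_eq_sub_of_hasDerivAt_of_le
    (f := fun θ => Real.cos θ ^ k * Real.sin θ ^ (2 * α + 1))
    (f' := fun θ => (2 * α + 1 + k) * (Real.sin θ ^ (2 * α) * Real.cos θ ^ (k + 1)) -
      k * (Real.sin θ ^ (2 * α) * Real.cos θ ^ (k - 1))) Real.pi_pos.le
    (by
      refine ContinuousOn.mul (by fun_prop) ?_
      exact Real.continuous_sin.continuousOn.rpow_const fun _ _ => Or.inr (by linarith))
    (fun θ hθ => by
      have hs := Real.sin_pos_of_pos_of_lt_pi hθ.1 hθ.2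
      have h1 := ((Real.hasDerivAt_cos θ).fun_pow k).mul
        ((Real.hasDerivAt_sin θ).rpow_const (p := 2 * α + 1) (Or.inl hs.ne'))
      convert! h1 using 1
      rw [Real.rpow_add_one hs.ne', show 2 * α + 1 - 1 = 2 * α by ring]
      have hc : Real.sin θ * Real.sin θ = 1 - Real.cos θ ^ 2 := by
        rw [← Real.sin_sq_add_cos_sq θ]; ring
      rcases k with _ | k
      · simp; ring
      · simp only [Nat.add_sub_cancel]
        linear_combination ((k + 1 : ℕ) : ℝ) * Real.cos θ ^ k * Real.sin θ ^ (2 * α) * hc)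
    (((hI _).const_mul _).sub ((hI _).const_mul _))
  rw [intervalIntegral.integral_sub ((hI _).const_mul _) ((hI _).const_mul _),
    intervalIntegral.integral_const_mul, intervalIntegral.integral_const_mul] at h
  simp only [Real.sin_pi, Real.sin_zero, Real.zero_rpow (by linarith : 2 * α + 1 ≠ 0),
    mul_zero, sub_zero] at h
  simp only [cosMoment, integral_angleMeasure hα, smul_eq_mul]
  linear_combination angleConst α * h

lemma cosMoment_odd {α : ℝ} (hα : -(1 / 2) < α) (k : ℕ) : cosMoment α (2 * k + 1) = 0 := by
  induction k with
  | zero =>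
    have := cosMoment_succ hα 0
    simp only [Nat.cast_zero, zero_mul, add_zero, mul_eq_zero] at this
    exact this.resolve_left (by linarith)
  | succ k ih =>
    have := cosMoment_succ hα (2 * k + 2)
    rw [show 2 * k + 2 - 1 = 2 * k + 1 by omega, ih, mul_zero] at this
    refine (mul_eq_zero.1 this).resolve_left ?_
    have : (0 : ℝ) ≤ ((2 * k + 2 : ℕ) : ℝ) := by positivity
    linarith

lemma cosMoment_even {α : ℝ} (hα : -(1 / 2) < α) (k : ℕ) :
    4 ^ k * k.factorial * rising (α + 1) k * cosMoment α (2 * k) = (2 * k).factorial := by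
  induction k with
  | zero => simp [cosMoment_zero hα, rising_zero]
  | succ k ih =>
    have h := cosMoment_succ hα (2 * k + 1)
    rw [show 2 * k + 1 - 1 = 2 * k by omega] at h
    rw [show 2 * (k + 1) = 2 * k + 1 + 1 by ring, Nat.factorial_succ (2 * k + 1),
      Nat.factorial_succ (2 * k), rising_succ, Nat.factorial_succ k]
    push_cast at h ⊢
    rw [← ih]
    linear_combination (4 ^ k * (k.factorial : ℝ) * rising (α + 1) k * 2 * (k + 1)) * h

lemma abs_cosMoment_le {α : ℝ} (hα : -(1 / 2) < α) (k : ℕ) : |cosMoment α k| ≤ 1 := by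
  have := isProbabilityMeasure_angleMeasure hα
  have h := norm_integral_le_of_norm_le_const (μ := angleMeasure α) (C := 1)
    (f := fun θ => Real.cos θ ^ k) (Filter.Eventually.of_forall fun θ => by
      rw [norm_pow]; exact pow_le_one₀ (norm_nonneg _) (Real.abs_cos_le_one θ))
  simpa [cosMoment] using h

/-! ### Power series and Poisson integral of the Bessel function. -/

/-- The coefficients of `j_α`. -/
def besselCoeff (α : ℝ) (k : ℕ) : ℝ := (-1) ^ k * cosMoment α (2 * k) / (2 * k).factorial

/-- Reconciles the moment form of the coefficients, which gives the bound by $1/(2k)!$ and the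
Poisson integral, with the Gamma quotients in `besselJ`. -/
lemma besselCoeff_eq {α : ℝ} (hα : -(1 / 2) < α) (k : ℕ) :
    besselCoeff α k = (-1) ^ k / (4 ^ k * k.factorial * rising (α + 1) k) := by
  have h := rising_pos (by linarith : 0 < α + 1) k
  rw [besselCoeff, ← cosMoment_even hα k]
  have h3 : cosMoment α (2 * k) ≠ 0 := fun h0 => by
    have := cosMoment_even hα k
    rw [h0, mul_zero] at this
    exact (Nat.factorial_pos (2 * k)).ne (by exact_mod_cast this)
  field_simp

lemma norm_besselCoeff_mul_pow_le {α : ℝ} (hα : -(1 / 2) < α) (k : ℕ) (z : ℝ) :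
    ‖besselCoeff α k * z ^ k‖ ≤ |z| ^ k / k.factorial := by
  rw [norm_mul, besselCoeff, norm_div, norm_mul, norm_pow, norm_neg, norm_one, one_pow, one_mul,
    norm_pow, RCLike.norm_natCast, Real.norm_eq_abs, Real.norm_eq_abs, div_mul_eq_mul_div]
  gcongr
  · exact mul_le_of_le_one_left (by positivity) (abs_cosMoment_le hα _)
  · linarith

lemma summable_norm_besselCoeff {α : ℝ} (hα : -(1 / 2) < α) (z : ℝ) :
    Summable fun k => ‖besselCoeff α k * z ^ k‖ :=
  Summable.of_nonneg_of_le (fun _ => norm_nonneg _) (norm_besselCoeff_mul_pow_le hα · z)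
    (Real.summable_pow_div_factorial |z|)

lemma besselJ_eq_tsum {α : ℝ} (hα : -(1 / 2) < α) (t : ℝ) :
    besselJ α t = ∑' k, besselCoeff α k * (t ^ 2) ^ k := by
  have hG1 : 0 < Real.Gamma (α + 1) := Real.Gamma_pos_of_pos (by linarith)
  rw [besselJ, ← tsum_mul_left]
  refine tsum_congr fun k => ?_
  have h := rising_pos (by linarith : 0 < α + 1) k
  rw [besselCoeff_eq hα, show α + k + 1 = α + 1 + k by ring, Gamma_add_nat (by linarith), div_pow,
    pow_mul 2 2 k, show (2 : ℝ) ^ 2 = 4 by norm_num, ← pow_mul]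
  field_simp

lemma hasSum_besselJ {α : ℝ} (hα : -(1 / 2) < α) (t : ℝ) :
    HasSum (fun k => besselCoeff α k * (t ^ 2) ^ k) (besselJ α t) := by
  rw [besselJ_eq_tsum hα]
  exact (summable_norm_besselCoeff hα _).of_norm.hasSum

/-- The Poisson integral for `j_α`. -/
lemma besselJ_eq_integral {α : ℝ} (hα : -(1 / 2) < α) (t : ℝ) :
    besselJ α t = ∫ θ, Real.cos (t * Real.cos θ) ∂(angleMeasure α) := by
  have := isProbabilityMeasure_angleMeasure hα
  have hb : ∀ (k : ℕ) (θ : ℝ),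
      ‖(-1) ^ k * (t * Real.cos θ) ^ (2 * k) / (2 * k).factorial‖ ≤
        (t ^ 2) ^ k / k.factorial := fun k θ => by
    rw [norm_div, norm_mul, norm_pow, norm_neg, norm_one, one_pow, one_mul,
      norm_pow, RCLike.norm_natCast, pow_mul, Real.norm_eq_abs, sq_abs]
    have : Real.cos θ ^ 2 ≤ 1 := Real.cos_sq_le_one θ
    have h2 : (t * Real.cos θ) ^ 2 ≤ t ^ 2 := by
      rw [mul_pow]; exact mul_le_of_le_one_right (by positivity) this
    have h3 : k ≤ 2 * k := by linarith
    exact div_le_div₀ (by positivity) (pow_le_pow_left₀ (by positivity) h2 k) (by positivity)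
      (by exact_mod_cast Nat.factorial_le h3)
  have hI : ∀ k : ℕ, Integrable
      (fun θ => (-1) ^ k * (t * Real.cos θ) ^ (2 * k) / ((2 * k).factorial : ℝ))
      (angleMeasure α) := fun k =>
    .of_bound (by fun_prop) _ (Filter.Eventually.of_forall (hb k))
  have h := hasSum_integral_of_summable_integral_norm hI
    (Summable.of_nonneg_of_le (fun k => integral_nonneg fun θ => norm_nonneg _)
      (fun k => (integral_mono (hI k).norm (integrable_const _) (hb k)).trans (by simp))
      (Real.summable_pow_div_factorial (t ^ 2)))
  simp_rw [(Real.hasSum_cos _).tsum_eq] at h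
  refine (hasSum_besselJ hα t).unique (h.congr_fun ?_)
  intro k
  simp only [mul_pow]
  rw [integral_div, integral_const_mul, integral_const_mul, besselCoeff, cosMoment, pow_mul t]
  ring

lemma abs_besselJ_le_one {α : ℝ} (hα : -(1 / 2) < α) (t : ℝ) : |besselJ α t| ≤ 1 := by
  have := isProbabilityMeasure_angleMeasure hα
  rw [besselJ_eq_integral hα]
  simpa using norm_integral_le_of_norm_le_const (μ := angleMeasure α) (C := 1)
    (f := fun θ => Real.cos (t * Real.cos θ))
    (Filter.Eventually.of_forall fun θ => Real.abs_cos_le_one _)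

lemma continuous_besselJ {α : ℝ} (hα : -(1 / 2) < α) : Continuous (besselJ α) := by
  have := isProbabilityMeasure_angleMeasure hα
  rw [show besselJ α = fun t => ∫ θ, Real.cos (t * Real.cos θ) ∂(angleMeasure α) from
    funext fun t => besselJ_eq_integral hα t]
  refine continuous_of_dominated (bound := fun _ => 1) (fun t => by fun_prop)
    (fun t => Filter.Eventually.of_forall fun θ => Real.abs_cos_le_one _)
    (integrable_const _) (Filter.Eventually.of_forall fun θ => by fun_prop)

lemma choose_left_mul_factorial_mul_factorial (i n : ℕ) :
    ((i + n).choose i : ℝ) * i.factorial * n.factorial = (i + n).factorial := by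
  rw [← Nat.choose_symm_of_eq_add (add_comm i n)]
  exact_mod_cast Nat.add_choose_mul_factorial_mul_factorial i n

/-! ### The product formula. -/

-- This is the degree-$k$ part of the product formula. After division by the $k$-th coefficient, the
-- left side is a trinomial expansion with even cosine moments, and Chu–Vandermonde expands the
-- right side into the same terms.
open Finset in
lemma integral_add_mul_cos_pow {α : ℝ} (hα : -(1 / 2) < α) (x y : ℝ) (k : ℕ) :
    besselCoeff α k * ∫ θ, (x ^ 2 + y ^ 2 + 2 * x * y * Real.cos θ) ^ k ∂(angleMeasure α) =
      ∑ il ∈ antidiagonal k,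
        (besselCoeff α il.1 * (x ^ 2) ^ il.1) * (besselCoeff α il.2 * (y ^ 2) ^ il.2) := by
  have hP := isProbabilityMeasure_angleMeasure hα
  have hr := fun k => (rising_pos (by linarith : 0 < α + 1) k).ne'
  -- expand the left-hand side
  have hcos : ∀ n : ℕ, Integrable (fun θ => Real.cos θ ^ n) (angleMeasure α) := fun n =>
    .of_bound (by fun_prop) 1 (Filter.Eventually.of_forall fun θ => by
      rw [norm_pow]; exact pow_le_one₀ (norm_nonneg _) (Real.abs_cos_le_one θ))
  have hL : ∫ θ, (x ^ 2 + y ^ 2 + 2 * x * y * Real.cos θ) ^ k ∂(angleMeasure α) =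
      ∑ m ∈ antidiagonal k, ∑ p ∈ antidiagonal m.2,
        (k.choose m.1 : ℝ) * (2 * x * y) ^ m.1 * cosMoment α m.1 *
          ((m.2.choose p.1 : ℝ) * (x ^ 2) ^ p.1 * (y ^ 2) ^ p.2) := by
    have h1 : ∀ θ, (x ^ 2 + y ^ 2 + 2 * x * y * Real.cos θ) ^ k = ∑ m ∈ antidiagonal k,
        ((k.choose m.1 : ℝ) * (2 * x * y) ^ m.1 * (x ^ 2 + y ^ 2) ^ m.2) *
          Real.cos θ ^ m.1 := fun θ => by
      rw [add_comm, (Commute.all _ _).add_pow']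
      refine sum_congr rfl fun m _ => ?_
      rw [mul_pow _ (Real.cos θ), nsmul_eq_mul]; ring
    simp_rw [h1]
    rw [integral_finsetSum _ fun m _ => (hcos _).const_mul _]
    refine sum_congr rfl fun m _ => ?_
    rw [integral_const_mul, ← cosMoment, (Commute.all (x ^ 2) (y ^ 2)).add_pow', ← mul_sum,
      mul_right_comm]
    congr 1
    refine sum_congr rfl fun p _ => ?_
    rw [nsmul_eq_mul]; ring
  -- The quotient of coefficients is $\binom{k}{i}(\alpha+1+n)_i/(\alpha+1)_i$, whose numerator
  -- Chu–Vandermonde opens into a sum over $j$.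
  have hR : ∀ il ∈ antidiagonal k,
      (besselCoeff α il.1 * (x ^ 2) ^ il.1) * (besselCoeff α il.2 * (y ^ 2) ^ il.2) =
      besselCoeff α k * ∑ j ∈ antidiagonal il.1, (k.choose il.1 : ℝ) * (il.1.choose j.1 : ℝ) *
        (il.2.descFactorial j.1 : ℝ) / rising (α + 1) j.1 * ((x ^ 2) ^ il.1 * (y ^ 2) ^ il.2) := by
    rintro ⟨i, n⟩ h
    obtain rfl : i + n = k := mem_antidiagonal.1 h
    have hV := chu_vandermonde i n (α + 1)
    have hT : ∑ j ∈ antidiagonal i, ((i + n).choose i : ℝ) * (i.choose j.1 : ℝ) *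
        (n.descFactorial j.1 : ℝ) / rising (α + 1) j.1 * ((x ^ 2) ^ i * (y ^ 2) ^ n) =
        ((i + n).choose i : ℝ) * (rising (α + 1 + n) i / rising (α + 1) i) *
          ((x ^ 2) ^ i * (y ^ 2) ^ n) := by
      rw [← hV, sum_div, mul_sum, sum_mul]
      refine sum_congr rfl fun j hj => ?_
      have h2 : rising (α + 1) i = rising (α + 1) j.1 * rising (α + 1 + j.1) j.2 := by
        rw [← rising_add, mem_antidiagonal.1 hj]
      have h3 := hr i
      rw [h2] at h3 ⊢
      have h4 := left_ne_zero_of_mul h3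
      have h5 := right_ne_zero_of_mul h3
      field_simp
    simp only
    rw [hT, besselCoeff_eq hα, besselCoeff_eq hα, besselCoeff_eq hα, add_comm i n,
      rising_add, pow_add, pow_add]
    have h1 := hr i
    have h2 := hr n
    have h3 : rising (α + 1 + n) i ≠ 0 :=
      (rising_pos (by have : (0 : ℝ) ≤ n := by positivity
                      linarith) i).ne'
    have h4 : ((n + i).choose i : ℝ) * i.factorial * n.factorial = (n + i).factorial := by
      rw [add_comm n i]
      exact choose_left_mul_factorial_mul_factorial i n
    have h5 : ((n + i).factorial : ℝ) ≠ 0 := by positivity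
    rw [← h4] at h5 ⊢
    have h6 := left_ne_zero_of_mul (left_ne_zero_of_mul h5)
    field_simp
  rw [sum_congr rfl hR, ← mul_sum, hL]
  congr 1
  -- match the two double sums
  rw [sum_sigma', sum_sigma', ← sum_filter_of_ne (p := fun s => Even s.1.1),
    ← sum_filter_of_ne (s := (antidiagonal k).sigma fun il => antidiagonal il.1)
      (p := fun s => s.2.1 ≤ s.1.2)]
  -- Trinomial term: $2j$ factors of the cross term, $p$ of $x^2$, $q$ of $y^2$. It has degree
  -- $i=j+p$ in $x^2$ and $n=j+q$ in $y^2$. Odd powers of the cross term and indices $j>n$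
  -- contribute zero and were discarded.
  · refine sum_nbij'
      (fun s => ⟨(s.1.1 / 2 + s.2.1, s.1.1 / 2 + s.2.2), (s.1.1 / 2, s.2.1)⟩)
      (fun s => ⟨(2 * s.2.1, s.2.2 + (s.1.2 - s.2.1)), (s.2.2, s.1.2 - s.2.1)⟩) ?_ ?_ ?_ ?_ ?_
    · rintro ⟨⟨m, m'⟩, ⟨p, q⟩⟩ h
      simp only [mem_filter, mem_sigma, HasAntidiagonal.mem_antidiagonal] at h ⊢
      obtain ⟨⟨h1, h2⟩, j, h3⟩ := h
      exact ⟨⟨by omega, trivial⟩, by omega⟩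
    · rintro ⟨⟨i, n⟩, ⟨j, l⟩⟩ h
      simp only [mem_filter, mem_sigma, HasAntidiagonal.mem_antidiagonal] at h ⊢
      exact ⟨⟨by omega, trivial⟩, even_two_mul _⟩
    · rintro ⟨⟨m, m'⟩, ⟨p, q⟩⟩ h
      simp only [mem_filter, mem_sigma, HasAntidiagonal.mem_antidiagonal] at h
      obtain ⟨⟨h1, h2⟩, j, h3⟩ := h
      have e1 : m / 2 = j := by omega
      have e2 : 2 * j = m := by omega
      simp [e1, e2, h2]
    · rintro ⟨⟨i, n⟩, ⟨j, l⟩⟩ h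
      simp only [mem_filter, mem_sigma, HasAntidiagonal.mem_antidiagonal] at h
      obtain ⟨⟨h1, h2⟩, h3⟩ := h
      have e1 : 2 * j / 2 = j := by omega
      simp [e1, h2, h3]
    · rintro ⟨⟨m, m'⟩, ⟨p, q⟩⟩ h
      simp only [mem_filter, mem_sigma, HasAntidiagonal.mem_antidiagonal] at h
      obtain ⟨⟨h1, h2⟩, j, h3⟩ := h
      obtain rfl : m = 2 * j := by omega
      obtain rfl := h2
      obtain rfl := h1
      have e1 : 2 * j / 2 = j := by omega
      simp only [e1]
      have hM := cosMoment_even hα j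
      have hM' : cosMoment α (2 * j) = (2 * j).factorial / (4 ^ j * j.factorial *
          rising (α + 1) j) := by
        rw [← hM]; have := hr j; field_simp
      have c1 : ((2 * j + (p + q)).choose (2 * j) : ℝ) =
          (2 * j + (p + q)).factorial / ((2 * j).factorial * (p + q).factorial) := by
        rw [eq_div_iff (by positivity)]
        rw [← mul_assoc]; exact choose_left_mul_factorial_mul_factorial _ _
      have c2 : ((p + q).choose p : ℝ) = (p + q).factorial / (p.factorial * q.factorial) := by
        rw [eq_div_iff (by positivity)]
        rw [← mul_assoc]; exact choose_left_mul_factorial_mul_factorial _ _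
      have c3 : ((2 * j + (p + q)).choose (j + p) : ℝ) =
          (2 * j + (p + q)).factorial / ((j + p).factorial * (j + q).factorial) := by
        rw [eq_div_iff (by positivity), show 2 * j + (p + q) = (j + p) + (j + q) by ring]
        rw [← mul_assoc]; exact choose_left_mul_factorial_mul_factorial _ _
      have c4 : ((j + p).choose j : ℝ) = (j + p).factorial / (j.factorial * p.factorial) := by
        rw [eq_div_iff (by positivity)]
        rw [← mul_assoc]; exact choose_left_mul_factorial_mul_factorial _ _
      have c5 : ((j + q).descFactorial j : ℝ) = (j + q).factorial / q.factorial := by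
        rw [eq_div_iff (by positivity)]
        have := Nat.factorial_mul_descFactorial (show j ≤ j + q by omega)
        rw [Nat.add_sub_cancel_left] at this
        rw [mul_comm]
        exact_mod_cast this
      rw [hM', c1, c2, c3, c4, c5, show (2 * x * y) ^ (2 * j) = 4 ^ j * (x ^ 2) ^ j * (y ^ 2) ^ j by
        rw [pow_mul, mul_pow, mul_pow, mul_pow, mul_pow]; norm_num, pow_add, pow_add]
      have := hr j
      field_simp
  · rintro ⟨⟨i, n⟩, ⟨j, l⟩⟩ _ h
    by_contra! hlt
    simp [Nat.descFactorial_eq_zero_iff_lt.2 hlt] at h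
  · rintro ⟨⟨m, m'⟩, ⟨p, q⟩⟩ _ h
    by_contra hodd
    obtain ⟨j, rfl⟩ := Nat.not_even_iff_odd.1 hodd
    simp [cosMoment_odd hα] at h

lemma sq_add_sq_add_cos_nonneg (x y θ : ℝ) :
    0 ≤ x ^ 2 + y ^ 2 + 2 * x * y * Real.cos θ := by
  nlinarith [sq_nonneg (x + y * Real.cos θ), Real.sin_sq_add_cos_sq θ,
    sq_nonneg (y * Real.sin θ)]

/-- The product formula for `j_α`. -/
lemma integral_besselJ_mul_sqrt {α : ℝ} (hα : -(1 / 2) < α) (x y l : ℝ) :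
    ∫ θ, besselJ α (Real.sqrt (x ^ 2 + y ^ 2 + 2 * x * y * Real.cos θ) * l) ∂(angleMeasure α) =
      besselJ α (x * l) * besselJ α (y * l) := by
  have hP := isProbabilityMeasure_angleMeasure hα
  have hw : ∀ θ, (Real.sqrt (x ^ 2 + y ^ 2 + 2 * x * y * Real.cos θ) * l) ^ 2 =
      (x * l) ^ 2 + (y * l) ^ 2 + 2 * (x * l) * (y * l) * Real.cos θ := fun θ => by
    rw [mul_pow, Real.sq_sqrt (sq_add_sq_add_cos_nonneg x y θ)]; ring
  generalize x * l = a at *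
  generalize y * l = b at *
  simp_rw [besselJ_eq_tsum hα, hw]
  -- $W=(|a|+|b|)^2$ dominates the argument for every angle, so the series may be integrated
  -- termwise.
  let W : ℝ := a ^ 2 + b ^ 2 + 2 * |a| * |b|
  have hb : ∀ (k : ℕ) (θ : ℝ), ‖besselCoeff α k * (a ^ 2 + b ^ 2 + 2 * a * b * Real.cos θ) ^ k‖ ≤
      W ^ k / k.factorial := fun k θ => by
    refine (norm_besselCoeff_mul_pow_le hα _ _).trans ?_
    gcongr
    rw [abs_of_nonneg (sq_add_sq_add_cos_nonneg a b θ)]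
    have : a * b * Real.cos θ ≤ |a| * |b| := by
      rw [← abs_mul]
      exact (le_abs_self _).trans (by
        rw [abs_mul]; exact mul_le_of_le_one_right (abs_nonneg _) (Real.abs_cos_le_one θ))
    linarith
  have hI : ∀ k : ℕ, Integrable
      (fun θ => besselCoeff α k * (a ^ 2 + b ^ 2 + 2 * a * b * Real.cos θ) ^ k)
      (angleMeasure α) := fun k =>
    .of_bound (by fun_prop) _ (Filter.Eventually.of_forall (hb k))
  have h := hasSum_integral_of_summable_integral_norm hI
    (Summable.of_nonneg_of_le (fun k => integral_nonneg fun θ => norm_nonneg _)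
      (fun k => (integral_mono (hI k).norm (integrable_const _) (hb k)).trans (by simp))
      (Real.summable_pow_div_factorial W))
  rw [← h.tsum_eq, tsum_mul_tsum_eq_tsum_sum_antidiagonal_of_summable_norm
    (summable_norm_besselCoeff hα _) (summable_norm_besselCoeff hα _)]
  refine tsum_congr fun k => ?_
  rw [integral_const_mul, integral_add_mul_cos_pow hα]

lemma translate_eq_integral {d : ℕ} {α : ℝ} (hα : -(1 / 2) < α) (x : Pt d) (φ : Pt d → ℂ)
    (y : Pt d) :
    translate α x φ y = ∫ θ, φ (x.1 + y.1,
      Real.sqrt (x.2 ^ 2 + y.2 ^ 2 + 2 * x.2 * y.2 * Real.cos θ)) ∂(angleMeasure α) := by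
  rw [integral_angleMeasure hα, translate, ← angleConst, Complex.real_smul]
  congr 1
  refine intervalIntegral.integral_congr fun θ _ => ?_
  simp only [Complex.real_smul, mul_comm]

/-! ### The measure -/

/-- The normalizing constant of the weighted measure. -/
def muConst (d : ℕ) (α : ℝ) : ℝ := (2 * Real.pi) ^ ((d : ℝ) / 2) * 2 ^ α * Real.Gamma (α + 1)

lemma muConst_pos (d : ℕ) {α : ℝ} (hα : -(1 / 2) < α) : 0 < muConst d α := by
  have : 0 < Real.Gamma (α + 1) := Real.Gamma_pos_of_pos (by linarith)
  have := Real.pi_pos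
  unfold muConst
  positivity

/-- The radial factor of the weighted measure. -/
def radialMeasure (d : ℕ) (α : ℝ) : Measure ℝ :=
  (volume.restrict (Set.Ioi 0)).withDensity fun t => ENNReal.ofReal (t ^ (2 * α + 1) / muConst d α)

instance sigmaFinite_radialMeasure (d : ℕ) (α : ℝ) : SigmaFinite (radialMeasure d α) :=
  SigmaFinite.withDensity_ofReal _

lemma isLocallyFiniteMeasure_radialMeasure (d : ℕ) {α : ℝ} (hα : -(1 / 2) < α) :
    IsLocallyFiniteMeasure (radialMeasure d α) := by
  have : Continuous fun t : ℝ => (t ^ (2 * α + 1) / muConst d α).toNNReal :=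
    continuous_real_toNNReal.comp
      ((Real.continuous_rpow_const (by linarith)).div_const _)
  exact IsLocallyFiniteMeasure.withDensity_coe this

lemma mu_eq_prod (d : ℕ) (α : ℝ) : mu d α = volume.prod (radialMeasure d α) := by
  have h : halfSpace d = Set.univ ×ˢ Set.Ioi 0 := by
    ext x; simp [halfSpace]
  rw [mu, h, radialMeasure, prod_withDensity_right,
    Measure.volume_eq_prod, ← Measure.prod_restrict, Measure.restrict_univ]
  · rfl
  · fun_prop

instance sigmaFinite_mu (d : ℕ) (α : ℝ) : SigmaFinite (mu d α) := by
  rw [mu_eq_prod]; infer_instance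

lemma isLocallyFiniteMeasure_mu (d : ℕ) {α : ℝ} (hα : -(1 / 2) < α) :
    IsLocallyFiniteMeasure (mu d α) := by
  have := isLocallyFiniteMeasure_radialMeasure d hα
  rw [mu_eq_prod]; infer_instance

lemma measurePreserving_refl (d : ℕ) (α : ℝ) :
    MeasurePreserving (refl : Pt d → Pt d) (mu d α) (mu d α) := by
  rw [mu_eq_prod]
  exact (Measure.measurePreserving_neg volume).prod (MeasurePreserving.id _)

lemma measurable_refl {d : ℕ} : Measurable (refl : Pt d → Pt d) :=
  (measurePreserving_refl d 0).measurable

lemma continuous_refl {d : ℕ} : Continuous (refl : Pt d → Pt d) := by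
  unfold refl; fun_prop

lemma refl_refl {d : ℕ} (x : Pt d) : refl (refl x) = x := by simp [refl]

/-- The reflection as a measurable equivalence. -/
def reflEquiv (d : ℕ) : Pt d ≃ᵐ Pt d where
  toFun := refl
  invFun := refl
  left_inv := refl_refl
  right_inv := refl_refl
  measurable_toFun := measurable_refl
  measurable_invFun := measurable_refl

lemma integral_comp_refl {d : ℕ} (α : ℝ) (f : Pt d → ℂ) :
    ∫ x, f (refl x) ∂(mu d α) = ∫ x, f x ∂(mu d α) :=
  (measurePreserving_refl d α).integral_comp (reflEquiv d).measurableEmbedding f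

lemma map_mul_radialMeasure (d : ℕ) (α : ℝ) {σ : ℝ} (hσ : 0 < σ) :
    (radialMeasure d α).map (σ * ·) =
      ENNReal.ofReal (σ⁻¹ * σ⁻¹ ^ (2 * α + 1)) • radialMeasure d α := by
  refine Measure.ext_of_lintegral _ fun f hf => ?_
  have hm : Measurable fun t : ℝ => ENNReal.ofReal (t ^ (2 * α + 1) / muConst d α) := by fun_prop
  rw [lintegral_map hf (by fun_prop), lintegral_smul_measure, radialMeasure,
    lintegral_withDensity_eq_lintegral_mul _ hm (by fun_prop),
    lintegral_withDensity_eq_lintegral_mul _ hm hf]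
  have h1 : ∀ t ∈ Set.Ioi (0 : ℝ), ((fun t : ℝ => ENNReal.ofReal (t ^ (2 * α + 1) / muConst d α)) *
      fun a => f (σ * a)) t = ENNReal.ofReal (σ⁻¹ ^ (2 * α + 1)) *
        ((fun u => ENNReal.ofReal (u ^ (2 * α + 1) / muConst d α)) * f) (σ * t) := fun t ht => by
    have ht : 0 < t := ht
    simp only [Pi.mul_apply]
    rw [← mul_assoc, ← ENNReal.ofReal_mul (by positivity), ← mul_div_assoc,
      ← Real.mul_rpow (by positivity) (by positivity), inv_mul_cancel_left₀ hσ.ne']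
  rw [setLIntegral_congr_fun measurableSet_Ioi h1, lintegral_const_mul _ (by fun_prop)]
  generalize hF : ((fun u => ENNReal.ofReal (u ^ (2 * α + 1) / muConst d α)) * f) = F
  have hFm : Measurable F := hF ▸ hm.mul hf
  have h2 : ∫⁻ t in Set.Ioi 0, F (σ * t) = ENNReal.ofReal σ⁻¹ * ∫⁻ t in Set.Ioi 0, F t := by
    rw [← lintegral_indicator measurableSet_Ioi, ← lintegral_indicator measurableSet_Ioi]
    have : (Set.Ioi (0 : ℝ)).indicator (fun t => F (σ * t)) =
        fun t => (Set.Ioi (0 : ℝ)).indicator F (σ * t) := by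
      ext t
      by_cases ht : 0 < t
      · rw [Set.indicator_of_mem (show t ∈ Set.Ioi 0 from ht),
          Set.indicator_of_mem (show σ * t ∈ Set.Ioi 0 from mul_pos hσ ht)]
      · rw [Set.indicator_of_notMem (show t ∉ Set.Ioi 0 from ht), Set.indicator_of_notMem
          (by simpa using mul_nonpos_of_nonneg_of_nonpos hσ.le (not_lt.1 ht))]
    rw [this, ← lintegral_map (hFm.indicator measurableSet_Ioi) (by fun_prop),
      Real.map_volume_mul_left hσ.ne', lintegral_smul_measure, abs_of_pos (inv_pos.2 hσ),
      smul_eq_mul]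
  rw [h2, ← mul_assoc, ← ENNReal.ofReal_mul (by positivity), smul_eq_mul,
    mul_comm (σ⁻¹ ^ (2 * α + 1))]

/-- The exact scaling factor is never needed: its finiteness shows that dilations preserve null sets
and every $L^p$. -/
lemma exists_map_smul_mu (d : ℕ) (α : ℝ) {σ : ℝ} (hσ : 0 < σ) :
    ∃ c : ℝ≥0∞, c ≠ ∞ ∧ (mu d α).map (σ • ·) = c • mu d α := by
  refine ⟨ENNReal.ofReal |(σ ^ d)⁻¹| * ENNReal.ofReal (σ⁻¹ * σ⁻¹ ^ (2 * α + 1)),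
    ENNReal.mul_ne_top ENNReal.ofReal_ne_top ENNReal.ofReal_ne_top, ?_⟩
  rw [mu_eq_prod, show (fun x : Pt d => σ • x) = Prod.map (σ • ·) (σ * ·) from rfl,
    ← Measure.map_prod_map _ _ (by fun_prop) (by fun_prop), Measure.map_addHaar_smul _ hσ.ne',
    map_mul_radialMeasure d α hσ, Measure.prod_smul_left, Measure.prod_smul_right, smul_smul,
    finrank_euclideanSpace_fin]

lemma quasiMeasurePreserving_smul (d : ℕ) (α : ℝ) {σ : ℝ} (hσ : 0 < σ) :
    Measure.QuasiMeasurePreserving (σ • · : Pt d → Pt d) (mu d α) (mu d α) := by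
  obtain ⟨c, -, h⟩ := exists_map_smul_mu d α hσ
  refine ⟨by fun_prop, ?_⟩
  rw [h]
  exact Measure.smul_absolutelyContinuous

lemma memLp_dilate {d : ℕ} {α : ℝ} {m : Pt d → ℂ} {p : ℝ≥0∞} (hm : MemLp m p (mu d α)) {σ : ℝ}
    (hσ : 0 < σ) : MemLp (dilate m σ) p (mu d α) := by
  obtain ⟨c, hc, h⟩ := exists_map_smul_mu d α hσ
  have h2 : MemLp m p ((mu d α).map (σ • ·)) := h ▸ hm.smul_measure hc
  exact h2.comp_of_map (by fun_prop)

/-! ### Gaussians -/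

/-- Half of the homogeneous dimension `d + 2α + 2`. -/
def halfDim (d : ℕ) (α : ℝ) : ℝ := (d : ℝ) / 2 + (α + 1)

/-- The Gaussian `exp (-t |x|² / 2)`. -/
def gauss {d : ℕ} (t : ℝ) (x : Pt d) : ℝ := Real.exp (-(t / 2) * (‖x.1‖ ^ 2 + x.2 ^ 2))

lemma gauss_pos {d : ℕ} (t : ℝ) (x : Pt d) : 0 < gauss t x := Real.exp_pos _

lemma continuous_gauss {d : ℕ} (t : ℝ) : Continuous (gauss t : Pt d → ℝ) := by
  unfold gauss; fun_prop

lemma gauss_le_one {d : ℕ} {t : ℝ} (ht : 0 ≤ t) (x : Pt d) : gauss t x ≤ 1 := by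
  rw [gauss, Real.exp_le_one_iff]
  nlinarith [mul_nonneg ht (add_nonneg (sq_nonneg ‖x.1‖) (sq_nonneg x.2))]

lemma gauss_mul_gauss {d : ℕ} (s t : ℝ) (x : Pt d) : gauss s x * gauss t x = gauss (s + t) x := by
  rw [gauss, gauss, gauss, ← Real.exp_add]; congr 1; ring

lemma gauss_refl {d : ℕ} (t : ℝ) (x : Pt d) : gauss t (refl x) = gauss t x := by
  simp [gauss, refl]

lemma integrableOn_rpow_mul_gauss {s t : ℝ} (hs : -1 < s) (ht : 0 < t) :
    IntegrableOn (fun u : ℝ => u ^ s * Real.exp (-(t / 2) * u ^ 2)) (Set.Ioi 0) :=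
  integrableOn_rpow_mul_exp_neg_mul_sq (by positivity) hs

/-- Integrating the Bessel series termwise, the rising factorial in each Gaussian moment cancels the
one in the coefficient, and an exponential series remains. -/
lemma hankel_gauss {α : ℝ} (hα : -(1 / 2) < α) {t : ℝ} (ht : 0 < t) (l : ℝ) :
    ∫ u in Set.Ioi (0 : ℝ), u ^ (2 * α + 1) * (Real.exp (-(t / 2) * u ^ 2) * besselJ α (u * l)) =
      2 ^ α * Real.Gamma (α + 1) * (t ^ (-(α + 1)) * Real.exp (-(1 / t / 2) * l ^ 2)) := by
  have hG1 : 0 < Real.Gamma (α + 1) := Real.Gamma_pos_of_pos (by linarith)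
  let F : ℕ → ℝ → ℝ := fun k u =>
    (besselCoeff α k * (l ^ 2) ^ k) *
      (u ^ (2 * α + 1 + (2 * k : ℕ)) * Real.exp (-(t / 2) * u ^ 2))
  have hk : ∀ k : ℕ, -1 < 2 * α + 1 + ((2 * k : ℕ) : ℝ) := fun k => by
    have : (0 : ℝ) ≤ ((2 * k : ℕ) : ℝ) := by positivity
    linarith
  have hI : ∀ k, Integrable (F k) (volume.restrict (Set.Ioi 0)) := fun k =>
    (integrableOn_rpow_mul_gauss (hk k) ht).const_mul _
  let A : ℝ := 2 ^ α * Real.Gamma (α + 1) * t ^ (-(α + 1))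
  have hA : 0 < A := by positivity
  have hpow : ∀ k : ℕ, ∫ u in Set.Ioi (0 : ℝ),
      u ^ (2 * α + 1 + ((2 * k : ℕ) : ℝ)) * Real.exp (-(t / 2) * u ^ 2) =
      A * ((2 / t) ^ k * rising (α + 1) k) := fun k => by
    have h := integral_rpow_mul_exp_neg_mul_rpow (p := 2) two_pos (hk k)
      (show 0 < t / 2 by positivity)
    simp only [Real.rpow_two] at h
    rw [h, show (2 * α + 1 + ((2 * k : ℕ) : ℝ) + 1) / 2 = α + 1 + k by push_cast; ring,
      show -(2 * α + 1 + ((2 * k : ℕ) : ℝ) + 1) / 2 = -(α + 1) + -k by push_cast; ring,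
      Gamma_add_nat (by linarith), Real.rpow_add (by positivity), Real.rpow_neg_natCast,
      zpow_neg, zpow_natCast, Real.div_rpow ht.le two_pos.le, Real.rpow_neg two_pos.le,
      Real.rpow_add_one two_ne_zero, ← inv_pow, inv_div]
    simp only [A]
    field_simp
  have hcoef : ∀ k : ℕ, besselCoeff α k * (l ^ 2) ^ k * (A * ((2 / t) ^ k * rising (α + 1) k)) =
      A * ((-(1 / t / 2) * l ^ 2) ^ k / k.factorial) := fun k => by
    have hr := rising_pos (by linarith : 0 < α + 1) k
    have h4 : (4 : ℝ) ^ k = 2 ^ k * 2 ^ k := by rw [← mul_pow]; norm_num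
    rw [besselCoeff_eq hα, show -(1 / t / 2) * l ^ 2 = -1 * (l ^ 2 / (2 * t)) by field_simp,
      mul_pow, div_pow, div_pow, mul_pow, h4]
    field_simp
  have hint : ∀ k, ∫ u in Set.Ioi (0 : ℝ), F k u =
      A * ((-(1 / t / 2) * l ^ 2) ^ k / k.factorial) := fun k => by
    rw [integral_const_mul, hpow, hcoef]
  -- Each term has constant sign on $(0,\infty)$, so its $L^1$ norm is the absolute value of its
  -- integral.
  have hnorm : ∀ k, ∫ u in Set.Ioi (0 : ℝ), ‖F k u‖ =
      ‖A * ((-(1 / t / 2) * l ^ 2) ^ k / k.factorial)‖ := fun k => by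
    rw [← hcoef, norm_mul _ (A * _), Real.norm_of_nonneg (r := A * _)
      (mul_nonneg hA.le (mul_nonneg (by positivity) (rising_pos (by linarith) k).le)), ← hpow,
      ← integral_const_mul]
    refine setIntegral_congr_fun measurableSet_Ioi fun u hu => ?_
    have hu : 0 < u := hu
    simp only [F]
    rw [norm_mul, Real.norm_of_nonneg (by positivity :
      0 ≤ u ^ (2 * α + 1 + ((2 * k : ℕ) : ℝ)) * Real.exp (-(t / 2) * u ^ 2))]
  have h := hasSum_integral_of_summable_integral_norm hI (by
    simp_rw [hnorm]
    exact (((Real.summable_pow_div_factorial _).mul_left A).norm))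
  simp_rw [hint] at h
  have hexp : HasSum (fun k : ℕ => A * ((-(1 / t / 2) * l ^ 2) ^ k / k.factorial))
      (A * Real.exp (-(1 / t / 2) * l ^ 2)) := by
    rw [Real.exp_eq_exp_ℝ]
    exact (NormedSpace.expSeries_div_hasSum_exp _).mul_left A
  rw [← mul_assoc]
  refine Eq.trans ?_ (h.unique hexp)
  refine setIntegral_congr_fun measurableSet_Ioi fun u hu => ?_
  have hu : 0 < u := hu
  rw [besselJ_eq_tsum hα, ← tsum_mul_left, ← tsum_mul_left]
  refine tsum_congr fun k => ?_
  simp only [F]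
  rw [Real.rpow_add hu (2 * α + 1), Real.rpow_natCast, mul_pow, pow_mul, mul_pow]
  ring

lemma integrable_gauss {d : ℕ} {α : ℝ} (hα : -(1 / 2) < α) {t : ℝ} (ht : 0 < t) :
    Integrable (gauss t : Pt d → ℝ) (mu d α) := by
  have h1 : Integrable (fun v : EuclideanSpace ℝ (Fin d) => Real.exp (-(t / 2) * ‖v‖ ^ 2)) := by
    have := (GaussianFourier.integrable_cexp_neg_mul_sq_norm_add (b := ((t / 2 : ℝ) : ℂ))
      (by simpa using ht) 0 (0 : EuclideanSpace ℝ (Fin d))).norm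
    refine this.congr (Filter.Eventually.of_forall fun v => ?_)
    simp only [zero_mul, add_zero, Complex.norm_exp]
    norm_cast
  have h2 : Integrable (fun u : ℝ => Real.exp (-(t / 2) * u ^ 2)) (radialMeasure d α) := by
    rw [radialMeasure, integrable_withDensity_iff_integrable_smul' (by fun_prop)
      (Filter.Eventually.of_forall fun _ => ENNReal.ofReal_lt_top)]
    refine ((integrableOn_rpow_mul_gauss (by linarith : -1 < 2 * α + 1) ht).div_const
      (muConst d α)).congr ?_
    filter_upwards [ae_restrict_mem measurableSet_Ioi] with u hu
    have hu : 0 < u := hu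
    have := muConst_pos d hα
    rw [ENNReal.toReal_ofReal (by positivity), smul_eq_mul]
    ring
  rw [mu_eq_prod]
  refine (h1.mul_prod h2).congr (Filter.Eventually.of_forall fun x => ?_)
  simp only [gauss]
  rw [← Real.exp_add]; congr 1; ring

lemma transformL1_gauss {d : ℕ} {α : ℝ} (hα : -(1 / 2) < α) {t : ℝ} (ht : 0 < t) (l : Pt d) :
    transformL1 α (fun x : Pt d => (gauss t x : ℂ)) l =
      ((t ^ (-halfDim d α) * gauss (1 / t) l : ℝ) : ℂ) := by
  have hG1 : 0 < Real.Gamma (α + 1) := Real.Gamma_pos_of_pos (by linarith)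
  have hpi := Real.pi_pos
  have hc := muConst_pos d hα
  have h1 : ∫ v : EuclideanSpace ℝ (Fin d), Complex.exp (-((t / 2 : ℝ) : ℂ) * ‖v‖ ^ 2 +
      (-Complex.I) * (inner ℝ l.1 v : ℝ)) =
      (((2 * Real.pi) ^ ((d : ℝ) / 2) * t ^ (-((d : ℝ) / 2)) *
        Real.exp (-(1 / t / 2) * ‖l.1‖ ^ 2) : ℝ) : ℂ) := by
    rw [GaussianFourier.integral_cexp_neg_mul_sq_norm_add (by simpa using ht),
      finrank_euclideanSpace_fin, ← Complex.ofReal_div]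
    rw [show ((d : ℂ) / 2) = (((d : ℝ) / 2 : ℝ) : ℂ) by push_cast; ring,
      ← Complex.ofReal_cpow (by positivity), Complex.ofReal_mul]
    congr 1
    · rw [show Real.pi / (t / 2) = 2 * Real.pi * t⁻¹ by field_simp, Real.mul_rpow (by positivity)
        (by positivity), Real.inv_rpow ht.le, Real.rpow_neg ht.le]
    · rw [Complex.ofReal_exp]
      congr 1
      have : (t : ℂ) ≠ 0 := by exact_mod_cast ht.ne'
      push_cast
      rw [neg_sq, Complex.I_sq]
      field_simp
      norm_num
  have h2 : ∫ u, ((Real.exp (-(t / 2) * u ^ 2) * besselJ α (u * l.2) : ℝ) : ℂ)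
      ∂(radialMeasure d α) = ((2 ^ α * Real.Gamma (α + 1) * (t ^ (-(α + 1)) *
        Real.exp (-(1 / t / 2) * l.2 ^ 2)) / muConst d α : ℝ) : ℂ) := by
    rw [integral_complex_ofReal, ← hankel_gauss hα ht, radialMeasure,
      integral_withDensity_eq_integral_toReal_smul (by fun_prop)
      (Filter.Eventually.of_forall fun _ => ENNReal.ofReal_lt_top), ← integral_div]
    congr 1
    refine setIntegral_congr_fun measurableSet_Ioi fun u hu => ?_
    have hu : 0 < u := hu
    rw [ENNReal.toReal_ofReal (by positivity), smul_eq_mul]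
    ring
  have h3 : ∀ x : Pt d, (gauss t x : ℂ) * kernel α l x =
      Complex.exp (-((t / 2 : ℝ) : ℂ) * ‖x.1‖ ^ 2 + (-Complex.I) * (inner ℝ l.1 x.1 : ℝ)) *
        ((Real.exp (-(t / 2) * x.2 ^ 2) * besselJ α (x.2 * l.2) : ℝ) : ℂ) := fun x => by
    rw [gauss, kernel, mul_add, Real.exp_add, Complex.exp_add, real_inner_comm x.1]
    push_cast
    ring
  rw [transformL1]
  simp_rw [h3]
  rw [mu_eq_prod, integral_prod_mul
    (fun v : EuclideanSpace ℝ (Fin d) => Complex.exp (-((t / 2 : ℝ) : ℂ) * ‖v‖ ^ 2 +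
      (-Complex.I) * (inner ℝ l.1 v : ℝ)))
    (fun u : ℝ => ((Real.exp (-(t / 2) * u ^ 2) * besselJ α (u * l.2) : ℝ) : ℂ)), h1, h2,
    ← Complex.ofReal_mul]
  congr 1
  rw [halfDim, neg_add ((d : ℝ) / 2) (α + 1), Real.rpow_add ht, gauss, mul_add, Real.exp_add, muConst]
  generalize t ^ (-(α + 1)) = a
  generalize t ^ (-((d : ℝ) / 2)) = b
  field_simp

/-! ### The transform of integrable functions -/

section TransformL1

variable {d : ℕ} {α : ℝ}

lemma kernel_comm (l x : Pt d) : kernel α l x = kernel α x l := by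
  rw [kernel, kernel, real_inner_comm, mul_comm x.2]

lemma kernel_refl_left (l x : Pt d) : kernel α (refl l) x = kernel α l (refl x) := by
  simp [kernel, refl]

lemma conj_kernel (l x : Pt d) : conj (kernel α l x) = kernel α (refl l) x := by
  simp [kernel, refl, ← Complex.exp_conj]

lemma norm_kernel_le_one (hα : -(1 / 2) < α) (l x : Pt d) : ‖kernel α l x‖ ≤ 1 := by
  rw [kernel, norm_mul, Complex.norm_exp, Complex.norm_real]
  simpa using abs_besselJ_le_one hα _

lemma continuous_kernel (hα : -(1 / 2) < α) :
    Continuous fun p : Pt d × Pt d => kernel α p.1 p.2 := by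
  have := continuous_besselJ hα
  unfold kernel
  fun_prop

lemma integrable_mul_kernel (hα : -(1 / 2) < α) {f : Pt d → ℂ} (hf : Integrable f (mu d α))
    (l : Pt d) : Integrable (fun x => f x * kernel α l x) (mu d α) :=
  hf.mul_bdd (c := 1) ((continuous_kernel hα).comp (by fun_prop :
    Continuous fun x : Pt d => (l, x))).aestronglyMeasurable
    (Filter.Eventually.of_forall fun x => norm_kernel_le_one hα l x)

lemma norm_mul_kernel_le (hα : -(1 / 2) < α) (f : Pt d → ℂ) (l x : Pt d) :
    ‖f x * kernel α l x‖ ≤ ‖f x‖ := by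
  rw [norm_mul]
  exact mul_le_of_le_one_right (norm_nonneg _) (norm_kernel_le_one hα l x)

lemma continuous_kernel_left (hα : -(1 / 2) < α) (x : Pt d) :
    Continuous fun l : Pt d => kernel α l x := by
  have := continuous_besselJ hα
  unfold kernel
  fun_prop

lemma continuous_transformL1 (hα : -(1 / 2) < α) {f : Pt d → ℂ} (hf : Integrable f (mu d α)) :
    Continuous (transformL1 α f) := by
  have h1 : ∀ l : Pt d, AEStronglyMeasurable (fun x => f x * kernel α l x) (mu d α) :=
    fun l => (integrable_mul_kernel hα hf l).aestronglyMeasurable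
  have h2 : ∀ l : Pt d, ∀ᵐ x ∂(mu d α), ‖f x * kernel α l x‖ ≤ ‖f x‖ :=
    fun l => Filter.Eventually.of_forall (norm_mul_kernel_le hα f l)
  have h3 : ∀ᵐ x ∂(mu d α), Continuous fun l : Pt d => f x * kernel α l x :=
    Filter.Eventually.of_forall fun x => continuous_const.mul (continuous_kernel_left hα x)
  exact continuous_of_dominated h1 h2 hf.norm h3

lemma norm_transformL1_le (hα : -(1 / 2) < α) {f : Pt d → ℂ} (hf : Integrable f (mu d α))
    (l : Pt d) : ‖transformL1 α f l‖ ≤ ∫ x, ‖f x‖ ∂(mu d α) :=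
  norm_integral_le_of_norm_le hf.norm
    (Filter.Eventually.of_forall fun x => norm_mul_kernel_le hα f l x)

lemma transformL1_comp_refl (f : Pt d → ℂ) (l : Pt d) :
    transformL1 α (fun x => f (refl x)) l = transformL1 α f (refl l) := by
  rw [transformL1, ← integral_comp_refl]
  simp only [refl_refl, transformL1, kernel_refl_left]

lemma conj_transformL1 (f : Pt d → ℂ) (l : Pt d) :
    conj (transformL1 α f l) = transformL1 α (fun x => conj (f x)) (refl l) := by
  rw [transformL1, transformL1, ← integral_conj]
  simp only [map_mul, conj_kernel]

lemma _root_.MeasureTheory.Integrable.comp_refl {f : Pt d → ℂ} (hf : Integrable f (mu d α)) :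
    Integrable (fun x => f (refl x)) (mu d α) :=
  (measurePreserving_refl d α).integrable_comp_of_integrable hf

lemma integrable_mul_transformL1_refl (hα : -(1 / 2) < α) {f g : Pt d → ℂ}
    (hf : Integrable f (mu d α)) (hg : Integrable g (mu d α)) :
    Integrable (fun x => f x * transformL1 α g (refl x)) (mu d α) :=
  hf.mul_bdd ((continuous_transformL1 hα hg).comp continuous_refl).aestronglyMeasurable
    (Filter.Eventually.of_forall fun _ => norm_transformL1_le hα hg _)

/-- The multiplication formula. -/
lemma integral_transformL1_mul (hα : -(1 / 2) < α) {f g : Pt d → ℂ}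
    (hf : Integrable f (mu d α)) (hg : Integrable g (mu d α)) :
    ∫ x, transformL1 α f x * g x ∂(mu d α) = ∫ x, f x * transformL1 α g x ∂(mu d α) := by
  simp only [transformL1, ← integral_const_mul, ← integral_mul_const]
  rw [integral_integral_swap]
  · simp only [kernel_comm (α := α), mul_comm (g _), mul_assoc]
  · have h := (hg.mul_prod hf).mul_bdd (c := 1) (continuous_kernel hα).aestronglyMeasurable
      (Filter.Eventually.of_forall fun p => norm_kernel_le_one hα p.1 p.2)
    refine h.congr (Filter.Eventually.of_forall fun p => ?_)
    simp only [Function.uncurry]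
    ring

/-- Generalized translates of inverse transforms. -/
lemma translate_transformL1_refl (hα : -(1 / 2) < α) {h : Pt d → ℂ} (hh : Integrable h (mu d α))
    (x y : Pt d) :
    translate α x (fun z => transformL1 α h (refl z)) (refl y) =
      transformL1 α (fun l => h l * kernel α (refl x) l) y := by
  have hP := isProbabilityMeasure_angleMeasure hα
  have hj := continuous_besselJ hα
  let z : ℝ → Pt d := fun θ => (x.1 + (refl y).1,
    Real.sqrt (x.2 ^ 2 + (refl y).2 ^ 2 + 2 * x.2 * (refl y).2 * Real.cos θ))
  have hz : Continuous z := by fun_prop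
  rw [translate_eq_integral hα]
  simp only [transformL1]
  rw [integral_integral_swap (f := fun θ l => h l * kernel α (refl (z θ)) l)]
  · refine integral_congr_ae (Filter.Eventually.of_forall fun l => ?_)
    simp only
    rw [integral_const_mul, mul_assoc]
    congr 1
    -- The exponential is independent of $\theta$, so the angular average acts only on the Bessel
    -- factor and the product formula applies.
    have : ∀ θ, kernel α (refl (z θ)) l =
        Complex.exp (-Complex.I * ((inner ℝ l.1 (y.1 - x.1) : ℝ) : ℂ)) *
          ((besselJ α (Real.sqrt (x.2 ^ 2 + y.2 ^ 2 + 2 * x.2 * y.2 * Real.cos θ) * l.2) : ℝ)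
            : ℂ) := fun θ => by
      simp only [kernel, refl, z, neg_add_rev, neg_neg, mul_comm l.2, sub_eq_add_neg]
    simp_rw [this]
    rw [integral_const_mul, integral_complex_ofReal, integral_besselJ_mul_sqrt hα]
    simp only [kernel, refl, inner_sub_right, inner_neg_right, mul_comm l.2]
    rw [show ∀ a b c e : ℂ, a * b * (c * e) = (a * c) * (b * e) by intros; ring,
      ← Complex.exp_add]
    push_cast
    ring_nf
  · refine (hh.comp_snd (angleMeasure α)).mul_bdd (c := 1)
      ((continuous_kernel hα).comp (by
        exact ((continuous_refl.comp (hz.comp continuous_fst)).prodMk continuous_snd) :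
          Continuous fun p : ℝ × Pt d => (refl (z p.1), p.2))).aestronglyMeasurable
      (Filter.Eventually.of_forall fun p => norm_kernel_le_one hα _ _)

/-! ### The heat kernel -/

/-- The heat kernel: the generalized translate of a Gaussian. -/
def heatKernel (α t : ℝ) (x y : Pt d) : ℝ :=
  ∫ θ, t ^ (-halfDim d α) * gauss (1 / t) ((y.1 - x.1,
    Real.sqrt (x.2 ^ 2 + y.2 ^ 2 + 2 * x.2 * y.2 * Real.cos θ)) : Pt d) ∂(angleMeasure α)

lemma integrable_ofReal_gauss (hα : -(1 / 2) < α) {t : ℝ} (ht : 0 < t) :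
    Integrable (fun x : Pt d => (gauss t x : ℂ)) (mu d α) := (integrable_gauss hα ht).ofReal

/-- The averaged Gaussian shows positivity and decay of the kernel; this transform expression makes
it the kernel of a multiplier. -/
lemma ofReal_heatKernel (hα : -(1 / 2) < α) {t : ℝ} (ht : 0 < t) (x y : Pt d) :
    (heatKernel α t x y : ℂ) =
      transformL1 α (fun l => (gauss t l : ℂ) * kernel α x l) (refl y) := by
  have h := translate_transformL1_refl hα (integrable_ofReal_gauss (d := d) hα ht) (refl x)
    (refl y)
  simp only [refl_refl, transformL1_gauss hα ht] at h
  rw [← h, translate_eq_integral hα, heatKernel, ← integral_complex_ofReal]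
  simp only [gauss_refl]
  simp only [refl, sub_eq_neg_add]

lemma heatKernel_nonneg {t : ℝ} (ht : 0 < t) (x y : Pt d) : 0 ≤ heatKernel α t x y :=
  integral_nonneg fun θ => mul_nonneg (by positivity) (gauss_pos _ _).le

lemma integrable_gaussian_angle (hα : -(1 / 2) < α) {t : ℝ} (ht : 0 < t) (x y : Pt d) :
    Integrable (fun θ => t ^ (-halfDim d α) * gauss (1 / t) ((y.1 - x.1,
      Real.sqrt (x.2 ^ 2 + y.2 ^ 2 + 2 * x.2 * y.2 * Real.cos θ)) : Pt d)) (angleMeasure α) := by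
  have hP := isProbabilityMeasure_angleMeasure hα
  refine Integrable.const_mul (.of_bound (C := 1) ((continuous_gauss _).comp
    (by fun_prop)).aestronglyMeasurable (Filter.Eventually.of_forall fun θ => ?_)) _
  exact (Real.norm_of_nonneg (gauss_pos _ _).le).le.trans (gauss_le_one (by positivity) _)

lemma heatKernel_le (hα : -(1 / 2) < α) {t : ℝ} (ht : 0 < t) (x y : Pt d) :
    heatKernel α t x y ≤ t ^ (-halfDim d α) := by
  have hP := isProbabilityMeasure_angleMeasure hα
  refine (integral_mono (integrable_gaussian_angle hα ht x y) (integrable_const _)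
    fun θ => mul_le_of_le_one_right (by positivity) (gauss_le_one (by positivity) _)).trans ?_
  simp

/-- Half of the Gaussian exponent is spent on $e^{-\delta^2/(4t)}$ and the other half is the
Gaussian at time $2t$; the power of $2$ corrects the prefactor. Positive last coordinates ensure
that the averaged squared distance is at least the Euclidean one. -/
lemma heatKernel_le_of_le (hα : -(1 / 2) < α) {t : ℝ} (ht : 0 < t) {x y : Pt d} {δ : ℝ}
    (hx : 0 < x.2) (hy : 0 < y.2) (hδ : δ ^ 2 ≤ ‖y.1 - x.1‖ ^ 2 + (y.2 - x.2) ^ 2) :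
    heatKernel α t x y ≤
      2 ^ halfDim d α * Real.exp (-(δ ^ 2 / 4) * t⁻¹) * heatKernel α (2 * t) x y := by
  rw [heatKernel, heatKernel, ← integral_const_mul]
  refine integral_mono (integrable_gaussian_angle hα ht x y)
    ((integrable_gaussian_angle hα (by positivity) x y).const_mul _) fun θ => ?_
  have hw := sq_add_sq_add_cos_nonneg x.2 y.2 θ
  have h1 : δ ^ 2 ≤ ‖y.1 - x.1‖ ^ 2 + (x.2 ^ 2 + y.2 ^ 2 + 2 * x.2 * y.2 * Real.cos θ) := by
    nlinarith [Real.neg_one_le_cos θ, mul_pos hx hy]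
  simp only [gauss, Real.sq_sqrt hw]
  generalize ‖y.1 - x.1‖ ^ 2 + (x.2 ^ 2 + y.2 ^ 2 + 2 * x.2 * y.2 * Real.cos θ) = S at h1 ⊢
  have h2 : (2 : ℝ) ^ halfDim d α * (2 * t) ^ (-halfDim d α) = t ^ (-halfDim d α) := by
    rw [Real.mul_rpow two_pos.le ht.le, ← mul_assoc, ← Real.rpow_add two_pos]; simp
  calc t ^ (-halfDim d α) * Real.exp (-(1 / t / 2) * S)
      ≤ t ^ (-halfDim d α) *
        (Real.exp (-(δ ^ 2 / 4) * t⁻¹) * Real.exp (-(1 / (2 * t) / 2) * S)) := by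
        rw [← Real.exp_add]
        gcongr
        have : 0 ≤ (S - δ ^ 2) * t⁻¹ := mul_nonneg (by linarith) (by positivity)
        have e : -(δ ^ 2 / 4) * t⁻¹ + -(1 / (2 * t) / 2) * S - (-(1 / t / 2) * S) =
          (S - δ ^ 2) * t⁻¹ / 4 := by field_simp; ring
        linarith
    _ = _ := by rw [← h2]; ring

lemma continuous_heatKernel (hα : -(1 / 2) < α) {t : ℝ} (ht : 0 < t) (x : Pt d) :
    Continuous (heatKernel α t x) := by
  have h : Continuous fun y => (heatKernel α t x y : ℂ) := by
    simp_rw [ofReal_heatKernel hα ht]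
    exact (continuous_transformL1 hα (integrable_mul_kernel hα
      (integrable_ofReal_gauss hα ht) x)).comp continuous_refl
  exact Complex.continuous_re.comp h

/-- The heat semigroup as a Fourier multiplier. -/
lemma transformL1_gauss_mul_transformL1 (hα : -(1 / 2) < α) {t : ℝ} (ht : 0 < t)
    {g : Pt d → ℂ} (hg : Integrable g (mu d α)) (x : Pt d) :
    transformL1 α (fun l => (gauss t l : ℂ) * transformL1 α g (refl l)) x =
      ∫ y, (heatKernel α t x y : ℂ) * g y ∂(mu d α) := by
  have h := integral_transformL1_mul hα (integrable_mul_kernel hα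
    (integrable_ofReal_gauss (d := d) hα ht) x) hg.comp_refl
  simp only [transformL1_comp_refl] at h
  rw [transformL1]
  simp_rw [ofReal_heatKernel hα ht, mul_right_comm _ (transformL1 α g _)]
  rw [← h, ← integral_comp_refl]
  simp only [refl_refl]

lemma integrable_heatKernel_mul (hα : -(1 / 2) < α) {t : ℝ} (ht : 0 < t)
    {g : Pt d → ℂ} (hg : Integrable g (mu d α)) (x : Pt d) :
    Integrable (fun y => (heatKernel α t x y : ℂ) * g y) (mu d α) :=
  hg.bdd_mul (c := t ^ (-halfDim d α)) (Complex.continuous_ofReal.comp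
    (continuous_heatKernel hα ht x)).aestronglyMeasurable
    (Filter.Eventually.of_forall fun y => by
      rw [Complex.norm_real, Real.norm_of_nonneg (heatKernel_nonneg ht x y)]
      exact heatKernel_le hα ht x y)

lemma integrable_heatKernel_mul_gauss (hα : -(1 / 2) < α) {t : ℝ} (ht : 0 < t) (x : Pt d) :
    Integrable (fun y => heatKernel α t x y * gauss 1 y) (mu d α) := by
  have := (integrable_heatKernel_mul hα ht (integrable_ofReal_gauss hα one_pos) x).re
  refine this.congr (Filter.Eventually.of_forall fun y => ?_)
  simp [← Complex.ofReal_mul]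

/-- Replaces the total mass of the heat kernel: testing against `gauss 1` instead of the constant
$1$ keeps everything integrable, and the multiplier $e^{-t|\lambda|^2/2}$ merely changes the
Gaussian parameter from $1$ to $1+t$. -/
lemma integral_heatKernel_mul_gauss (hα : -(1 / 2) < α) {t : ℝ} (ht : 0 < t) (x : Pt d) :
    ∫ y, heatKernel α t x y * gauss 1 y ∂(mu d α) =
      (1 + t) ^ (-halfDim d α) * gauss (1 / (1 + t)) x := by
  have h := transformL1_gauss_mul_transformL1 hα ht (integrable_ofReal_gauss (d := d) hα one_pos) x
  simp only [transformL1_gauss hα one_pos, Real.one_rpow, one_mul, div_one, gauss_refl,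
    ← Complex.ofReal_mul, gauss_mul_gauss, integral_complex_ofReal] at h
  rw [transformL1_gauss hα (by positivity)] at h
  rw [add_comm 1 t]
  exact_mod_cast h.symm

lemma halfDim_pos (hα : -(1 / 2) < α) : 0 < halfDim d α := by
  unfold halfDim
  have : (0 : ℝ) ≤ d := by positivity
  linarith

lemma integral_heatKernel_mul_gauss_le_one (hα : -(1 / 2) < α) {t : ℝ} (ht : 0 < t) (x : Pt d) :
    ∫ y, heatKernel α t x y * gauss 1 y ∂(mu d α) ≤ 1 := by
  rw [integral_heatKernel_mul_gauss hα ht]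
  refine mul_le_one₀ ?_ (gauss_pos _ _).le (gauss_le_one (by positivity) _)
  exact Real.rpow_le_one_of_one_le_of_nonpos (by linarith) (by linarith [halfDim_pos (d := d) hα])

lemma ae_pos (d : ℕ) (α : ℝ) : ∀ᵐ x ∂(mu d α), 0 < x.2 := by
  have hm : MeasurableSet (halfSpace d) := measurableSet_lt measurable_const measurable_snd
  exact (withDensity_absolutelyContinuous _ _).ae_le (ae_restrict_mem hm)

/-- The bound is uniform in $t$ and $x$, as dominated convergence requires. -/
lemma norm_integral_heatKernel_mul_le (hα : -(1 / 2) < α) {k : Pt d → ℂ} {K : ℝ}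
    (hK : ∀ y, ‖k y‖ ≤ K) {t : ℝ} (ht : 0 < t) (x : Pt d) :
    ‖∫ y, (heatKernel α t x y : ℂ) * (gauss 1 y * k y) ∂(mu d α)‖ ≤ K := by
  have hK0 : 0 ≤ K := (norm_nonneg _).trans (hK 0)
  refine (norm_integral_le_of_norm_le ((integrable_heatKernel_mul_gauss hα ht x).mul_const K)
    (Filter.Eventually.of_forall fun y => ?_)).trans ?_
  · rw [norm_mul, norm_mul, Complex.norm_real, Complex.norm_real,
      Real.norm_of_nonneg (heatKernel_nonneg ht x y), Real.norm_of_nonneg (gauss_pos _ _).le,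
      ← mul_assoc]
    exact mul_le_mul_of_nonneg_left (hK y)
      (mul_nonneg (heatKernel_nonneg ht x y) (gauss_pos _ _).le)
  · rw [integral_mul_const]
    exact mul_le_of_le_one_left hK0 (integral_heatKernel_mul_gauss_le_one hα ht x)

-- The heat kernel is an approximate identity. With $k(y)$ replaced by $k(x)$ the integral is
-- explicit. The error is small near $x$ by continuity, and away from $x$ by the exponential factor
-- of `heatKernel_le_of_le`.
open Filter Topology in
lemma tendsto_integral_heatKernel_mul (hα : -(1 / 2) < α) {k : Pt d → ℂ} (hk : Continuous k)
    {K : ℝ} (hK : ∀ y, ‖k y‖ ≤ K) {x : Pt d} (hx : 0 < x.2) :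
    Tendsto (fun t => ∫ y, (heatKernel α t x y : ℂ) * (gauss 1 y * k y) ∂(mu d α)) (𝓝[>] 0)
      (𝓝 (gauss 1 x * k x)) := by
  have hK0 : 0 ≤ K := (norm_nonneg _).trans (hK 0)
  have hmain : Tendsto (fun t : ℝ => (((1 + t) ^ (-halfDim d α) * gauss (1 / (1 + t)) x : ℝ) : ℂ) *
      k x) (𝓝[>] 0) (𝓝 (gauss 1 x * k x)) := by
    have hc : ContinuousAt (fun t : ℝ => (((1 + t) ^ (-halfDim d α) *
        gauss (1 / (1 + t)) x : ℝ) : ℂ) * k x) 0 := by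
      unfold gauss
      refine ContinuousAt.mul (Complex.continuous_ofReal.continuousAt.comp ?_) continuousAt_const
      refine ContinuousAt.mul (ContinuousAt.rpow_const (by fun_prop) (by simp)) ?_
      have : ContinuousAt (fun t : ℝ => 1 / (1 + t)) 0 :=
        continuousAt_const.div (by fun_prop) (by simp)
      fun_prop
    have := hc.tendsto.mono_left (nhdsWithin_le_nhds (s := Set.Ioi 0))
    simpa using this
  suffices hdiff : Tendsto (fun t => ∫ y, (heatKernel α t x y : ℂ) * (gauss 1 y * k y) ∂(mu d α) -
      (((1 + t) ^ (-halfDim d α) * gauss (1 / (1 + t)) x : ℝ) : ℂ) * k x) (𝓝[>] 0) (𝓝 0) by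
    simpa using hdiff.add hmain
  rw [Metric.tendsto_nhds]
  intro ε hε
  obtain ⟨δ, hδ, hkδ⟩ := Metric.continuousAt_iff.1 hk.continuousAt (ε / 2) (by positivity)
  have hexp : Tendsto (fun t : ℝ => 2 * K * (2 ^ halfDim d α *
      Real.exp (-(δ ^ 2 / 4) * t⁻¹))) (𝓝[>] 0) (𝓝 0) := by
    have h1 : Tendsto (fun t : ℝ => -(δ ^ 2 / 4) * t⁻¹) (𝓝[>] 0) atBot :=
      tendsto_inv_nhdsGT_zero.const_mul_atTop_of_neg (by simp; positivity)
    simpa using ((Real.tendsto_exp_atBot.comp h1).const_mul (2 ^ halfDim d α)).const_mul (2 * K)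
  filter_upwards [self_mem_nhdsWithin, hexp.eventually (gt_mem_nhds (half_pos hε))] with t ht hte
  have ht : 0 < t := ht
  have hI1 : Integrable (fun y => (heatKernel α t x y : ℂ) * (gauss 1 y * k y)) (mu d α) :=
    integrable_heatKernel_mul hα ht ((integrable_ofReal_gauss hα one_pos).mul_bdd
      hk.aestronglyMeasurable (Filter.Eventually.of_forall hK)) x
  have hI2 : Integrable (fun y => ((heatKernel α t x y * gauss 1 y : ℝ) : ℂ) * k x) (mu d α) :=
    (integrable_heatKernel_mul_gauss hα ht x).ofReal.mul_const _
  have hG := integrable_heatKernel_mul_gauss (d := d) hα ht x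
  have hG2 := integrable_heatKernel_mul_gauss (d := d) hα (mul_pos two_pos ht) x
  rw [dist_zero_right, ← integral_heatKernel_mul_gauss hα ht, ← integral_complex_ofReal,
    ← integral_mul_const, ← integral_sub hI1 hI2]
  set C := 2 * K * (2 ^ halfDim d α * Real.exp (-(δ ^ 2 / 4) * t⁻¹)) with hC
  have hC0 : 0 ≤ C := by positivity
  have hle : ‖∫ y, ((heatKernel α t x y : ℂ) * (gauss 1 y * k y) -
      ((heatKernel α t x y * gauss 1 y : ℝ) : ℂ) * k x) ∂(mu d α)‖ ≤
      ∫ y, ((heatKernel α t x y * gauss 1 y) * (ε / 2) +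
        C * (heatKernel α (2 * t) x y * gauss 1 y)) ∂(mu d α) := by
    refine norm_integral_le_of_norm_le ((hG.mul_const _).add (hG2.const_mul _)) ?_
    filter_upwards [ae_pos d α] with y hy
    have h0 := heatKernel_nonneg (α := α) ht x y
    have h02 := heatKernel_nonneg (α := α) (mul_pos two_pos ht) x y
    have hg := (gauss_pos 1 y).le
    rw [Complex.ofReal_mul, mul_assoc, ← mul_sub, ← mul_sub, norm_mul, norm_mul, Complex.norm_real,
      Complex.norm_real, Real.norm_of_nonneg h0, Real.norm_of_nonneg hg, ← mul_assoc]
    by_cases hd : dist y x < δ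
    · have := (hkδ hd).le
      rw [dist_eq_norm] at this
      have h3 := mul_le_mul_of_nonneg_left this (mul_nonneg h0 hg)
      have h4 : 0 ≤ C * (heatKernel α (2 * t) x y * gauss 1 y) := by positivity
      linarith
    · have h5 : δ ^ 2 ≤ ‖y.1 - x.1‖ ^ 2 + (y.2 - x.2) ^ 2 := by
        rw [not_lt, Prod.dist_eq, le_max_iff, dist_eq_norm, Real.dist_eq] at hd
        rcases hd with hd | hd
        · nlinarith [sq_nonneg (y.2 - x.2)]
        · nlinarith [sq_nonneg ‖y.1 - x.1‖, sq_abs (y.2 - x.2)]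
      have h6 := heatKernel_le_of_le hα ht hx hy h5
      have h7 : ‖k y - k x‖ ≤ 2 * K := (norm_sub_le _ _).trans (by linarith [hK y, hK x])
      calc heatKernel α t x y * gauss 1 y * ‖k y - k x‖
          ≤ (2 ^ halfDim d α * Real.exp (-(δ ^ 2 / 4) * t⁻¹) * heatKernel α (2 * t) x y) *
              gauss 1 y * (2 * K) := by gcongr
        _ = C * (heatKernel α (2 * t) x y * gauss 1 y) := by rw [hC]; ring
        _ ≤ _ := le_add_of_nonneg_left (by positivity)
  refine hle.trans_lt ?_
  rw [integral_add (hG.mul_const _) (hG2.const_mul _), integral_mul_const, integral_const_mul]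
  have h8 := integral_heatKernel_mul_gauss_le_one (d := d) hα ht x
  have h9 := integral_heatKernel_mul_gauss_le_one (d := d) hα (mul_pos two_pos ht) x
  have h10 := mul_le_mul_of_nonneg_right h8 (half_pos hε).le
  have h11 := mul_le_mul_of_nonneg_left h9 hC0
  linarith

end TransformL1

/-! ### Plancherel theorem and inversion -/

section Plancherel

open Filter Topology
open scoped CompactlySupported

variable {d : ℕ} {α : ℝ}

lemma eLpNorm_two_sq {β : Type*} [MeasurableSpace β] (μ : Measure β) (f : β → ℂ) :
    eLpNorm f 2 μ ^ 2 = ∫⁻ x, ‖f x‖ₑ ^ 2 ∂μ := by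
  have h := eLpNorm_nnreal_pow_eq_lintegral (μ := μ) (f := f) (p := 2) two_ne_zero
  simpa using h

/-- Puts test functions in the form that the approximate identity accepts. -/
lemma exists_eq_gauss_mul (g : C_c(Pt d, ℂ)) : ∃ (k : Pt d → ℂ) (K : ℝ), Continuous k ∧
    (∀ y, ‖k y‖ ≤ K) ∧ ∀ y, g y = gauss 1 y * k y := by
  have hc : Continuous fun y : Pt d => (gauss 1 y : ℂ)⁻¹ * g y :=
    (Continuous.inv₀ (Complex.continuous_ofReal.comp (continuous_gauss 1))
      fun y => Complex.ofReal_ne_zero.2 (gauss_pos 1 y).ne').mul g.continuous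
  obtain ⟨K, hK⟩ := (g.hasCompactSupport.mul_left
    (f := fun y : Pt d => (gauss 1 y : ℂ)⁻¹)).exists_bound_of_continuous hc
  exact ⟨_, K, hc, hK, fun y => by
    rw [mul_inv_cancel_left₀ (Complex.ofReal_ne_zero.2 (gauss_pos 1 y).ne')]⟩

lemma memLp_compactlySupported (hα : -(1 / 2) < α) (g : C_c(Pt d, ℂ)) (p : ℝ≥0∞) :
    MemLp g p (mu d α) :=
  have := isLocallyFiniteMeasure_mu d hα
  g.continuous.memLp_of_hasCompactSupport g.hasCompactSupport

lemma integrable_compactlySupported (hα : -(1 / 2) < α) (g : C_c(Pt d, ℂ)) :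
    Integrable g (mu d α) :=
  memLp_one_iff_integrable.1 (memLp_compactlySupported hα g 1)

/-- Functions are determined by their integrals against continuous compactly supported functions. -/
lemma ae_eq_of_forall_integral_mul_eq {f f' : Pt d → ℂ}
    (hf : LocallyIntegrable f (mu d α)) (hf' : LocallyIntegrable f' (mu d α))
    (h : ∀ g : C_c(Pt d, ℂ), ∫ x, f x * g x ∂(mu d α) = ∫ x, f' x * g x ∂(mu d α)) :
    f =ᵐ[mu d α] f' := by
  refine ae_eq_of_integral_contDiff_smul_eq hf hf' fun g hg hgc => ?_
  have := h ⟨⟨fun x => (g x : ℂ), Complex.continuous_ofReal.comp hg.continuous⟩,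
    hgc.comp_left (g := Complex.ofReal) Complex.ofReal_zero⟩
  simpa [mul_comm] using this

/-- Parseval with a Gaussian cutoff: the multiplication formula turns the left side into $f$ paired
with the heat flow of $g$, which converges boundedly to $g$. -/
lemma tendsto_integral_transformL1_mul_gauss (hα : -(1 / 2) < α) {f : Pt d → ℂ}
    (hf : Integrable f (mu d α)) (g : C_c(Pt d, ℂ)) :
    Tendsto (fun t => ∫ l, transformL1 α f l * (gauss t l * transformL1 α g (refl l)) ∂(mu d α))
      (𝓝[>] 0) (𝓝 (∫ x, f x * g x ∂(mu d α))) := by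
  obtain ⟨k, K, hk, hK, hgk⟩ := exists_eq_gauss_mul g
  have hg := integrable_compactlySupported hα g
  have h1 : ∀ t : ℝ, 0 < t →
      ∫ l, transformL1 α f l * (gauss t l * transformL1 α g (refl l)) ∂(mu d α) =
      ∫ x, f x * ∫ y, (heatKernel α t x y : ℂ) * g y ∂(mu d α) ∂(mu d α) := fun t ht => by
    rw [integral_transformL1_mul hα hf
      (integrable_mul_transformL1_refl hα (integrable_ofReal_gauss hα ht) hg)]
    simp_rw [transformL1_gauss_mul_transformL1 hα ht hg]
  have hev : ∀ᶠ t : ℝ in 𝓝[>] 0, 0 < t := self_mem_nhdsWithin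
  refine Tendsto.congr' (hev.mono fun t ht => (h1 t ht).symm) ?_
  refine tendsto_integral_filter_of_dominated_convergence (fun x => ‖f x‖ * K)
    (hev.mono fun t ht => ?_) (hev.mono fun t ht => ?_) (hf.norm.mul_const K) ?_
  · have : Continuous fun x => ∫ y, (heatKernel α t x y : ℂ) * g y ∂(mu d α) := by
      simp_rw [← transformL1_gauss_mul_transformL1 hα ht hg]
      exact continuous_transformL1 hα
        (integrable_mul_transformL1_refl hα (integrable_ofReal_gauss hα ht) hg)
    exact hf.aestronglyMeasurable.mul this.aestronglyMeasurable
  · refine Eventually.of_forall fun x => ?_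
    rw [norm_mul]
    simp_rw [hgk]
    exact mul_le_mul_of_nonneg_left (norm_integral_heatKernel_mul_le hα hK ht x) (norm_nonneg _)
  · filter_upwards [ae_pos d α] with x hx
    simp_rw [hgk]
    exact (tendsto_integral_heatKernel_mul hα hk hK hx).const_mul _

lemma tendsto_gauss_zero (l : Pt d) : Tendsto (fun t => gauss t l) (𝓝[>] 0) (𝓝 1) := by
  have : Continuous fun t => gauss t l := by unfold gauss; fun_prop
  simpa [gauss] using (this.tendsto 0).mono_left (nhdsWithin_le_nhds (s := Set.Ioi 0))

/-- Parseval's formula. -/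
lemma integral_transformL1_mul_transformL1_refl (hα : -(1 / 2) < α) {f : Pt d → ℂ}
    (hf : Integrable f (mu d α)) (g : C_c(Pt d, ℂ))
    (hfg : Integrable (fun l => transformL1 α f l * transformL1 α g (refl l)) (mu d α)) :
    ∫ l, transformL1 α f l * transformL1 α g (refl l) ∂(mu d α) =
      ∫ x, f x * g x ∂(mu d α) := by
  refine tendsto_nhds_unique ?_ (tendsto_integral_transformL1_mul_gauss hα hf g)
  have hev : ∀ᶠ t : ℝ in 𝓝[>] 0, 0 < t := self_mem_nhdsWithin
  refine tendsto_integral_filter_of_dominated_convergence _ (Eventually.of_forall fun t => ?_)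
    (hev.mono fun t ht => Eventually.of_forall fun l => ?_) hfg.norm
    (Eventually.of_forall fun l => ?_)
  · have : AEStronglyMeasurable (fun l : Pt d => (gauss t l : ℂ)) (mu d α) :=
      (Complex.continuous_ofReal.comp (continuous_gauss t)).aestronglyMeasurable
    refine (this.mul hfg.aestronglyMeasurable).congr (Eventually.of_forall fun l => ?_)
    simp only [Pi.mul_apply]; ring
  · rw [mul_left_comm, norm_mul, Complex.norm_real, Real.norm_of_nonneg (gauss_pos _ _).le]
    exact mul_le_of_le_one_left (norm_nonneg _) (gauss_le_one ht.le l)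
  · have := (Complex.continuous_ofReal.tendsto 1).comp (tendsto_gauss_zero l)
    simpa using (this.mul_const (transformL1 α g (refl l))).const_mul (transformL1 α f l)

/-- Take $f=\bar g$ in the cutoff Parseval formula, so that the integrand becomes a Gaussian times
$|G|^2\ge0$. -/
lemma eLpNorm_transformL1_compactlySupported (hα : -(1 / 2) < α) (g : C_c(Pt d, ℂ)) :
    eLpNorm (transformL1 α g) 2 (mu d α) = eLpNorm g 2 (mu d α) := by
  have hg := integrable_compactlySupported hα g
  have hg2 := memLp_compactlySupported hα g 2
  let f : Pt d → ℂ := fun x => conj (g x)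
  have hf : Integrable f (mu d α) := by
    refine hg.congr' (Complex.continuous_conj.comp g.continuous).aestronglyMeasurable
      (Eventually.of_forall fun x => ?_)
    simp [f]
  let G : Pt d → ℂ := fun l => transformL1 α g (refl l)
  have hGc : Continuous G := (continuous_transformL1 hα hg).comp continuous_refl
  have hFG : ∀ l, transformL1 α f l = conj (G l) := fun l => by
    rw [conj_transformL1, refl_refl]
  have hfg : ∫ x, f x * g x ∂(mu d α) = ((∫ x, ‖g x‖ ^ 2 ∂(mu d α) : ℝ) : ℂ) := by
    rw [← integral_complex_ofReal]
    refine integral_congr_ae (Eventually.of_forall fun x => ?_)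
    simp only [f, Complex.conj_mul', Complex.ofReal_pow]
  have hsq : ∀ φ : Pt d → ℂ, ∀ x, ENNReal.ofReal (‖φ x‖ ^ 2) = ‖φ x‖ₑ ^ 2 := fun φ x => by
    rw [ENNReal.ofReal_pow (norm_nonneg _), ofReal_norm]
  have hlim := tendsto_integral_transformL1_mul_gauss hα hf g
  have hlim' : Tendsto (fun t => ∫⁻ l, ENNReal.ofReal (gauss t l * ‖G l‖ ^ 2) ∂(mu d α))
      (𝓝[>] 0) (𝓝 (ENNReal.ofReal (∫ x, ‖g x‖ ^ 2 ∂(mu d α)))) := by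
    rw [hfg] at hlim
    have h2 := (ENNReal.continuous_ofReal.tendsto _).comp ((Complex.continuous_re.tendsto _).comp hlim)
    rw [Complex.ofReal_re] at h2
    have hev : ∀ᶠ t : ℝ in 𝓝[>] 0, 0 < t := self_mem_nhdsWithin
    refine h2.congr' (hev.mono fun t ht => ?_)
    have h3 : ∀ l, transformL1 α f l * (gauss t l * transformL1 α g (refl l)) =
        ((gauss t l * ‖G l‖ ^ 2 : ℝ) : ℂ) := fun l => by
      rw [hFG, mul_left_comm, Complex.conj_mul']; push_cast; rfl
    simp only [Function.comp_apply, h3]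
    rw [integral_complex_ofReal, Complex.ofReal_re, ofReal_integral_eq_lintegral_ofReal]
    · have : Integrable (fun l => transformL1 α f l * (gauss t l * transformL1 α g (refl l)))
          (mu d α) := (integrable_mul_transformL1_refl hα
            (integrable_ofReal_gauss hα ht) hg).bdd_mul
          (continuous_transformL1 hα hf).aestronglyMeasurable
          (Eventually.of_forall fun l => norm_transformL1_le hα hf l)
      refine this.re.congr (Eventually.of_forall fun l => ?_)
      simp only [h3]; exact Complex.ofReal_re _
    · exact Eventually.of_forall fun l => mul_nonneg (gauss_pos _ _).le (sq_nonneg _)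
  -- Fatou gives only an inequality, but it puts $G$ in $L^2$, and then Parseval without cutoff
  -- gives equality.
  have hfatou : ∫⁻ l, ‖G l‖ₑ ^ 2 ∂(mu d α) ≤ ENNReal.ofReal (∫ x, ‖g x‖ ^ 2 ∂(mu d α)) := by
    have h4 : ∀ l, ‖G l‖ₑ ^ 2 =
        liminf (fun t => ENNReal.ofReal (gauss t l * ‖G l‖ ^ 2)) (𝓝[>] 0) := fun l => by
      have := (ENNReal.continuous_ofReal.tendsto _).comp
        ((tendsto_gauss_zero l).mul_const (‖G l‖ ^ 2))
      rw [one_mul, hsq] at this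
      exact this.liminf_eq.symm
    simp_rw [h4]
    refine (lintegral_liminf_le fun t => ?_).trans hlim'.liminf_eq.le
    exact (ENNReal.continuous_ofReal.comp
      ((continuous_gauss t).mul (hGc.norm.pow 2))).measurable
  have hG2 : MemLp G 2 (mu d α) := by
    refine ⟨hGc.aestronglyMeasurable, ?_⟩
    refine lt_top_iff_ne_top.2 fun h => ?_
    have h6 := hfatou.trans_lt ENNReal.ofReal_lt_top
    rw [← eLpNorm_two_sq, h] at h6
    simp at h6
  have hint : Integrable (fun l => transformL1 α f l * transformL1 α g (refl l)) (mu d α) := by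
    refine (hG2.integrable_norm_pow two_ne_zero).ofReal (𝕜 := ℂ) |>.congr
      (Eventually.of_forall fun l => ?_)
    simp only [hFG]
    rw [show transformL1 α g (refl l) = G l from rfl, Complex.conj_mul']
    simp
  have hP := integral_transformL1_mul_transformL1_refl hα hf g hint
  rw [hfg] at hP
  have hP' : ∫ l, ‖G l‖ ^ 2 ∂(mu d α) = ∫ x, ‖g x‖ ^ 2 ∂(mu d α) := by
    have h5 : ∀ l, transformL1 α f l * transformL1 α g (refl l) = ((‖G l‖ ^ 2 : ℝ) : ℂ) :=
      fun l => by rw [hFG, show transformL1 α g (refl l) = G l from rfl, Complex.conj_mul']; simp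
    simp_rw [h5] at hP
    rw [integral_complex_ofReal] at hP
    exact_mod_cast hP
  have hP'' : eLpNorm G 2 (mu d α) ^ 2 = eLpNorm g 2 (mu d α) ^ 2 := by
    have := congrArg ENNReal.ofReal hP'
    rw [ofReal_integral_eq_lintegral_ofReal (hG2.integrable_norm_pow two_ne_zero)
      (Eventually.of_forall fun l => sq_nonneg _),
      ofReal_integral_eq_lintegral_ofReal (hg2.integrable_norm_pow two_ne_zero)
      (Eventually.of_forall fun l => sq_nonneg _)] at this
    simp_rw [hsq] at this
    rwa [eLpNorm_two_sq, eLpNorm_two_sq]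
  rw [← eLpNorm_comp_measurePreserving (continuous_transformL1 hα hg).aestronglyMeasurable
    (measurePreserving_refl d α)]
  exact (ENNReal.pow_right_strictMono two_ne_zero).injective hP''

lemma memLp_transformL1_compactlySupported (hα : -(1 / 2) < α) (g : C_c(Pt d, ℂ)) :
    MemLp (transformL1 α g) 2 (mu d α) :=
  ⟨(continuous_transformL1 hα (integrable_compactlySupported hα g)).aestronglyMeasurable, by
    rw [eLpNorm_transformL1_compactlySupported hα]
    exact (memLp_compactlySupported hα g 2).2⟩

/-! ### Extension to $L^2$ by density. -/

/-- The class in `L²` of a continuous compactly supported function. -/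
def toL2 (hα : -(1 / 2) < α) : C_c(Pt d, ℂ) →ₗ[ℂ] Lp ℂ 2 (mu d α) where
  toFun g := (memLp_compactlySupported hα g 2).toLp g
  map_add' _ _ := rfl
  map_smul' _ _ := rfl

lemma denseRange_toL2 (hα : -(1 / 2) < α) : DenseRange (toL2 (d := d) hα) := by
  have := isLocallyFiniteMeasure_mu d hα
  refine fun h => EMetric.mem_closure_iff.2 fun ε hε => ?_
  obtain ⟨δ, hδ, hδε⟩ := exists_between hε
  obtain ⟨g, hgc, hg, hgcont, hg2⟩ :=
    (Lp.memLp h).exists_hasCompactSupport_eLpNorm_sub_le ENNReal.ofNat_ne_top hδ.ne'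
  refine ⟨_, ⟨⟨⟨g, hgcont⟩, hgc⟩, rfl⟩, lt_of_le_of_lt ?_ hδε⟩
  rw [Lp.edist_def]
  refine le_of_eq_of_le (eLpNorm_congr_ae ?_) hg
  exact (EventuallyEq.refl _ _).sub (MemLp.coeFn_toLp hg2)

/-- The transform of a continuous compactly supported function as an element of `L²`. -/
def transformToL2 (hα : -(1 / 2) < α) : C_c(Pt d, ℂ) →ₗ[ℂ] Lp ℂ 2 (mu d α) where
  toFun g := (memLp_transformL1_compactlySupported hα g).toLp _
  map_add' f g := by
    rw [← MemLp.toLp_add]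
    refine MemLp.toLp_congr _ _ (Eventually.of_forall fun l => ?_)
    simp only [transformL1, Pi.add_apply, CompactlySupportedContinuousMap.coe_add, add_mul]
    exact integral_add (integrable_mul_kernel hα (integrable_compactlySupported hα f) l)
      (integrable_mul_kernel hα (integrable_compactlySupported hα g) l)
  map_smul' c g := by
    rw [RingHom.id_apply, ← MemLp.toLp_const_smul]
    refine MemLp.toLp_congr _ _ (Eventually.of_forall fun l => ?_)
    simp only [transformL1, Pi.smul_apply, CompactlySupportedContinuousMap.coe_smul, smul_eq_mul,
      mul_assoc]
    exact integral_const_mul _ _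

lemma norm_transformToL2 (hα : -(1 / 2) < α) (g : C_c(Pt d, ℂ)) :
    ‖transformToL2 hα g‖ = ‖toL2 hα g‖ := by
  refine (Lp.norm_toLp _ (memLp_transformL1_compactlySupported hα g)).trans ?_
  rw [eLpNorm_transformL1_compactlySupported hα]
  exact (Lp.norm_toLp _ (memLp_compactlySupported hα g 2)).symm

/-- The `L²` transform as a continuous linear map. -/
def transformL2 (hα : -(1 / 2) < α) : Lp ℂ 2 (mu d α) →L[ℂ] Lp ℂ 2 (mu d α) :=
  (transformToL2 hα).extendOfNorm (toL2 hα)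

lemma transformL2_toL2 (hα : -(1 / 2) < α) (g : C_c(Pt d, ℂ)) :
    transformL2 hα (toL2 hα g) = transformToL2 hα g :=
  LinearMap.extendOfNorm_eq (denseRange_toL2 hα)
    ⟨1, fun g => by rw [norm_transformToL2, one_mul]⟩ g

lemma norm_transformL2 (hα : -(1 / 2) < α) (h : Lp ℂ 2 (mu d α)) : ‖transformL2 hα h‖ = ‖h‖ :=
  (denseRange_toL2 hα).induction_on h (isClosed_eq (by fun_prop) (by fun_prop))
    fun g => by rw [transformL2_toL2, norm_transformToL2]

lemma integrable_L2_mul {β : Type*} [MeasurableSpace β] {μ : Measure β} {f g : β → ℂ}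
    (hf : MemLp f 2 μ) (hg : MemLp g 2 μ) : Integrable (fun x => f x * g x) μ :=
  hf.integrable_mul hg

/-- The pairing is the inner product with $\bar\varphi$. Its continuity makes the multiplication
formulas closed conditions, so they can be checked on a dense set. -/
lemma continuous_integral_L2_mul {β : Type*} [MeasurableSpace β] {μ : Measure β} {φ : β → ℂ}
    (hφ : MemLp φ 2 μ) : Continuous fun h : Lp ℂ 2 μ => ∫ x, h x * φ x ∂μ := by
  have : ∀ h : Lp ℂ 2 μ, ∫ x, h x * φ x ∂μ = inner ℂ (hφ.star.toLp (star φ)) h := fun h => by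
    rw [L2.inner_def]
    refine integral_congr_ae ?_
    filter_upwards [MemLp.coeFn_toLp hφ.star] with x hx
    rw [hx]
    simp [RCLike.inner_apply]
  simp_rw [this]
  fun_prop

lemma toL2_ae (hα : -(1 / 2) < α) (g : C_c(Pt d, ℂ)) : toL2 hα g =ᵐ[mu d α] g :=
  MemLp.coeFn_toLp (memLp_compactlySupported hα g 2)

lemma transformToL2_ae (hα : -(1 / 2) < α) (g : C_c(Pt d, ℂ)) :
    transformToL2 hα g =ᵐ[mu d α] transformL1 α g :=
  MemLp.coeFn_toLp (memLp_transformL1_compactlySupported hα g)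

lemma integral_transformL2_mul (hα : -(1 / 2) < α) (h : Lp ℂ 2 (mu d α)) (k : C_c(Pt d, ℂ)) :
    ∫ x, transformL2 hα h x * k x ∂(mu d α) = ∫ x, h x * transformL1 α k x ∂(mu d α) := by
  refine (denseRange_toL2 hα).induction_on h (isClosed_eq
    ((continuous_integral_L2_mul (memLp_compactlySupported hα k 2)).comp
      (transformL2 hα).continuous)
    (continuous_integral_L2_mul (memLp_transformL1_compactlySupported hα k))) fun g => ?_
  rw [transformL2_toL2]
  refine Eq.trans (integral_congr_ae ?_) ((integral_transformL1_mul hα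
    (integrable_compactlySupported hα g) (integrable_compactlySupported hα k)).trans
    (integral_congr_ae ?_))
  · filter_upwards [transformToL2_ae hα g] with x hx; rw [hx]
  · filter_upwards [toL2_ae hα g] with x hx; rw [hx]

/-- Both sides have the same pairings with test functions, by the two multiplication formulas. -/
lemma transformL2_ae (hα : -(1 / 2) < α) {φ : Pt d → ℂ} (h1 : Integrable φ (mu d α))
    (h2 : MemLp φ 2 (mu d α)) : transformL2 hα (h2.toLp φ) =ᵐ[mu d α] transformL1 α φ := by
  have := isLocallyFiniteMeasure_mu d hα
  refine ae_eq_of_forall_integral_mul_eq ((Lp.memLp _).locallyIntegrable (by norm_num))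
    (continuous_transformL1 hα h1).locallyIntegrable fun k => ?_
  rw [integral_transformL2_mul, integral_transformL1_mul hα h1 (integrable_compactlySupported hα k)]
  refine integral_congr_ae ?_
  filter_upwards [h2.coeFn_toLp] with x hx
  rw [hx]

lemma memLp_transformL1 (hα : -(1 / 2) < α) {φ : Pt d → ℂ} (h1 : Integrable φ (mu d α))
    (h2 : MemLp φ 2 (mu d α)) : MemLp (transformL1 α φ) 2 (mu d α) :=
  (Lp.memLp _).ae_eq (transformL2_ae hα h1 h2)

lemma memLp_comp_refl {p : ℝ≥0∞} {φ : Pt d → ℂ} (h : MemLp φ p (mu d α)) :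
    MemLp (fun x => φ (refl x)) p (mu d α) :=
  h.comp_measurePreserving (measurePreserving_refl d α)

/-- Pairing with a test function and moving the transform across reduces this to Parseval. It yields
surjectivity and identifies the inverse on $L^1\cap L^2$. -/
lemma transformL2_transformL1_refl (hα : -(1 / 2) < α) {b : Pt d → ℂ}
    (h1 : Integrable b (mu d α)) (h2 : MemLp b 2 (mu d α)) :
    transformL2 hα ((memLp_comp_refl (memLp_transformL1 hα h1 h2)).toLp _) = h2.toLp b := by
  have := isLocallyFiniteMeasure_mu d hα
  refine Lp.ext (EventuallyEq.trans ?_ h2.coeFn_toLp.symm)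
  refine ae_eq_of_forall_integral_mul_eq ((Lp.memLp _).locallyIntegrable (by norm_num))
    (h2.locallyIntegrable (by norm_num)) fun k => ?_
  rw [integral_transformL2_mul, ← integral_transformL1_mul_transformL1_refl hα h1 k
    (integrable_L2_mul (memLp_transformL1 hα h1 h2)
      (memLp_comp_refl (memLp_transformL1_compactlySupported hα k))),
    ← integral_comp_refl α (fun l => transformL1 α b l * _)]
  refine integral_congr_ae ?_
  filter_upwards [(memLp_comp_refl (memLp_transformL1 hα h1 h2)).coeFn_toLp] with x hx
  rw [hx, refl_refl]

/-- The `L²` transform as a linear isometry. -/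
def transformIsometry (hα : -(1 / 2) < α) : Lp ℂ 2 (mu d α) →ₗᵢ[ℂ] Lp ℂ 2 (mu d α) where
  toLinearMap := (transformL2 hα).toLinearMap
  norm_map' h := norm_transformL2 hα h

lemma surjective_transformIsometry (hα : -(1 / 2) < α) :
    Function.Surjective (transformIsometry (d := d) hα) := by
  have hcl : IsClosed (Set.range (transformIsometry (d := d) hα)) :=
    (transformIsometry hα).isometry.isClosedEmbedding.isClosed_range
  intro h
  refine (denseRange_toL2 hα).induction_on (p := fun h => h ∈ Set.range (transformIsometry hα)) h
    hcl fun g => ?_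
  exact ⟨_, transformL2_transformL1_refl hα (integrable_compactlySupported hα g)
    (memLp_compactlySupported hα g 2)⟩

/-- `plancherel` is a choice, so the surjective isometry just built is the witness that makes it
meaningful. -/
lemma isPlancherelExtension_plancherel (hα : -(1 / 2) < α) :
    IsPlancherelExtension d α (plancherel d α) :=
  Classical.epsilon_spec (p := IsPlancherelExtension d α)
    ⟨LinearIsometryEquiv.ofSurjective (transformIsometry hα) (surjective_transformIsometry hα),
      fun _ h1 h2 => transformL2_ae hα (memLp_one_iff_integrable.1 h1) h2⟩

lemma plancherel_apply (hα : -(1 / 2) < α) (h : Lp ℂ 2 (mu d α)) :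
    plancherel d α h = transformL2 hα h := by
  refine (denseRange_toL2 hα).induction_on h
    (isClosed_eq (plancherel d α).continuous (transformL2 hα).continuous) fun g => ?_
  rw [transformL2_toL2]
  exact Lp.ext ((isPlancherelExtension_plancherel hα g (memLp_compactlySupported hα g 1)
    (memLp_compactlySupported hα g 2)).trans (transformToL2_ae hα g).symm)

lemma plancherel_symm_ae (hα : -(1 / 2) < α) {b : Pt d → ℂ}
    (h1 : Integrable b (mu d α)) (h2 : MemLp b 2 (mu d α)) :
    (plancherel d α).symm (h2.toLp b) =ᵐ[mu d α] fun l => transformL1 α b (refl l) := by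
  rw [← transformL2_transformL1_refl hα h1 h2, ← plancherel_apply,
    LinearIsometryEquiv.symm_apply_apply]
  exact MemLp.coeFn_toLp _

/-- The multiplication formula in `L²`. -/
lemma integral_plancherel_mul (hα : -(1 / 2) < α) (a c : Lp ℂ 2 (mu d α)) :
    ∫ x, plancherel d α a x * c x ∂(mu d α) = ∫ x, a x * plancherel d α c x ∂(mu d α) := by
  simp_rw [mul_comm (plancherel d α a _), mul_comm (a _)]
  refine (denseRange_toL2 hα).induction_on c (isClosed_eq
    (continuous_integral_L2_mul (Lp.memLp _))
    ((continuous_integral_L2_mul (Lp.memLp a)).comp (plancherel d α).continuous)) fun g => ?_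
  rw [plancherel_apply hα, plancherel_apply hα, transformL2_toL2]
  refine Eq.trans (integral_congr_ae ?_) ((integral_transformL2_mul hα a g).trans
    (integral_congr_ae ?_))
  · filter_upwards [toL2_ae hα g] with x hx; rw [hx, mul_comm]
  · filter_upwards [transformToL2_ae hα g] with x hx; rw [hx, mul_comm]

/-- The $L^2$ inverse of the transform of $b$ has the same pairings with test functions as $b$, by
the $L^2$ multiplication formula and Parseval, hence equals $b$ almost everywhere. -/
lemma memLp_two_of_transformL1 (hα : -(1 / 2) < α) {b : Pt d → ℂ}
    (h1 : Integrable b (mu d α)) (h2 : MemLp (transformL1 α b) 2 (mu d α)) :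
    MemLp b 2 (mu d α) := by
  have := isLocallyFiniteMeasure_mu d hα
  let h := (plancherel d α).symm (h2.toLp _)
  have hh : h =ᵐ[mu d α] b := by
    refine ae_eq_of_forall_integral_mul_eq ((Lp.memLp _).locallyIntegrable (by norm_num))
      h1.locallyIntegrable fun g => ?_
    have hgr := memLp_comp_refl (memLp_transformL1_compactlySupported hα g)
    have key := transformL2_transformL1_refl hα (integrable_compactlySupported hα g)
      (memLp_compactlySupported hα g 2)
    rw [← plancherel_apply] at key
    have hm := integral_plancherel_mul hα h (hgr.toLp _)
    rw [key, LinearIsometryEquiv.apply_symm_apply] at hm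
    rw [← integral_transformL1_mul_transformL1_refl hα h1 g (integrable_L2_mul h2 hgr)]
    refine Eq.trans (integral_congr_ae ?_) (hm.symm.trans (integral_congr_ae ?_))
    · filter_upwards [(memLp_compactlySupported hα g 2).coeFn_toLp] with x hx; rw [hx]
    · filter_upwards [h2.coeFn_toLp, hgr.coeFn_toLp] with x hx hx'; rw [hx, hx']
  exact (Lp.memLp h).ae_eq hh

/-- Plancherel's formula for integrable functions, both sides possibly infinite. -/
lemma eLpNorm_transformL1 (hα : -(1 / 2) < α) {b : Pt d → ℂ} (h1 : Integrable b (mu d α)) :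
    eLpNorm (transformL1 α b) 2 (mu d α) = eLpNorm b 2 (mu d α) := by
  by_cases h2 : MemLp b 2 (mu d α)
  · rw [← eLpNorm_congr_ae (transformL2_ae hα h1 h2), ← eLpNorm_congr_ae h2.coeFn_toLp,
      ← ENNReal.toReal_eq_toReal_iff' (Lp.eLpNorm_ne_top _) (Lp.eLpNorm_ne_top _),
      ← Lp.norm_def, ← Lp.norm_def, norm_transformL2]
  · have h3 : ¬ MemLp (transformL1 α b) 2 (mu d α) :=
      fun h => h2 (memLp_two_of_transformL1 hα h1 h)
    have e1 : eLpNorm b 2 (mu d α) = ∞ := by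
      by_contra h; exact h2 ⟨h1.aestronglyMeasurable, lt_top_iff_ne_top.2 h⟩
    have e2 : eLpNorm (transformL1 α b) 2 (mu d α) = ∞ := by
      by_contra h
      exact h3 ⟨(continuous_transformL1 hα h1).aestronglyMeasurable, lt_top_iff_ne_top.2 h⟩
    rw [e1, e2]

/-- The inversion formula. -/
lemma transformL1_transformL1_refl_ae (hα : -(1 / 2) < α) {f : Pt d → ℂ}
    (h1 : Integrable f (mu d α)) (h2 : Integrable (transformL1 α f) (mu d α)) :
    (fun x => transformL1 α (transformL1 α f) (refl x)) =ᵐ[mu d α] f := by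
  have := isLocallyFiniteMeasure_mu d hα
  -- Tested against $g$, the multiplication formula moves the outer transform onto $g$, and Parseval
  -- finishes.
  refine ae_eq_of_forall_integral_mul_eq
    ((continuous_transformL1 hα h2).comp continuous_refl).locallyIntegrable
    h1.locallyIntegrable fun g => ?_
  have hg := integrable_compactlySupported hα g
  rw [← integral_transformL1_mul_transformL1_refl hα h1 g
    (integrable_mul_transformL1_refl hα h2 hg),
    ← integral_comp_refl α (fun x => transformL1 α (transformL1 α f) (refl x) * g x)]
  simp only [refl_refl]
  rw [integral_transformL1_mul hα h2 hg.comp_refl]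
  simp only [transformL1_comp_refl]

end Plancherel

/-! ### Calderón's formula -/

section Calderon

open Filter

variable {d : ℕ} {α : ℝ}

instance sigmaFinite_scaleMeasure : SigmaFinite scaleMeasure := SigmaFinite.withDensity_ofReal _

lemma ae_scaleMeasure_pos : ∀ᵐ σ ∂scaleMeasure, 0 < σ :=
  (withDensity_absolutelyContinuous _ _).ae_le (ae_restrict_mem measurableSet_Ioi)

/-- Gives joint measurability of $(\sigma,x)\mapsto m(\sigma x)$ when $m$ is only almost everywhere
strongly measurable, as Tonelli and Fubini require. -/
lemma quasiMeasurePreserving_prod_smul (d : ℕ) (α : ℝ) :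
    Measure.QuasiMeasurePreserving (fun p : ℝ × Pt d => p.1 • p.2)
      (scaleMeasure.prod (mu d α)) (mu d α) := by
  have hm : Measurable fun p : ℝ × Pt d => p.1 • p.2 := by fun_prop
  refine ⟨hm, Measure.AbsolutelyContinuous.mk fun s hs h0 => ?_⟩
  rw [Measure.map_apply hm hs, Measure.measure_prod_null (hm hs)]
  filter_upwards [ae_scaleMeasure_pos] with σ hσ
  exact (quasiMeasurePreserving_smul d α hσ).preimage_null h0

lemma aestronglyMeasurable_dilate {m : Pt d → ℂ} (hm : AEStronglyMeasurable m (mu d α)) :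
    AEStronglyMeasurable (fun p : ℝ × Pt d => dilate m p.1 p.2) (scaleMeasure.prod (mu d α)) :=
  hm.comp_quasiMeasurePreserving (quasiMeasurePreserving_prod_smul d α)

/-- Integrating out the scale in an admissible symbol. -/
lemma lintegral_lintegral_dilate_sq_mul {m : Pt d → ℂ} (hm : AEStronglyMeasurable m (mu d α))
    (hadm : Admissible α m) {u : Pt d → ℝ≥0∞} (hu : AEMeasurable u (mu d α))
    (hu' : ∀ x, u x ≠ ∞) :
    ∫⁻ σ, ∫⁻ x, ‖dilate m σ x‖ₑ ^ 2 * u x ∂(mu d α) ∂scaleMeasure = ∫⁻ x, u x ∂(mu d α) := by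
  rw [lintegral_lintegral_swap
    (((aestronglyMeasurable_dilate hm).enorm.pow_const 2).mul hu.comp_snd)]
  refine lintegral_congr_ae ?_
  filter_upwards [hadm] with x hx
  -- Finiteness of `u x` lets it be pulled out without measurability of the section in $\sigma$.
  rw [lintegral_mul_const' _ _ (hu' x), hx, one_mul]

lemma transform_ae (hα : -(1 / 2) < α) {φ : Pt d → ℂ} (h2 : MemLp φ 2 (mu d α)) :
    transform α φ =ᵐ[mu d α] plancherel d α (h2.toLp φ) := by
  unfold transform
  split_ifs with h1
  · exact (isPlancherelExtension_plancherel hα φ h1 h2).symm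
  · rfl

lemma invTransform_ae (hα : -(1 / 2) < α) {b : Pt d → ℂ} (h2 : MemLp b 2 (mu d α)) :
    invTransform α b =ᵐ[mu d α] (plancherel d α).symm (h2.toLp b) := by
  unfold invTransform
  split_ifs with h1
  · exact (plancherel_symm_ae hα (memLp_one_iff_integrable.1 h1) h2).symm
  · rfl

lemma invTransform_of_integrable {g : Pt d → ℂ} (hg : Integrable g (mu d α)) :
    invTransform α g = fun l => transformL1 α g (refl l) :=
  if_pos (memLp_one_iff_integrable.2 hg)

/-- A product of two $L^2$ functions is in $L^1$, so the inverse transform is always the integral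
here, and the extended Plancherel formula covers infinite norms. -/
lemma eLpNorm_multiplier_sq (hα : -(1 / 2) < α) {m : Pt d → ℂ} (hm : MemLp m 2 (mu d α))
    {φ : Pt d → ℂ} (hφ : MemLp φ 2 (mu d α)) {σ : ℝ} (hσ : 0 < σ) :
    eLpNorm (multiplier α m σ φ) 2 (mu d α) ^ 2 =
      ∫⁻ x, ‖dilate m σ x‖ₑ ^ 2 * ‖transform α φ x‖ₑ ^ 2 ∂(mu d α) := by
  have hT : MemLp (transform α φ) 2 (mu d α) := (Lp.memLp _).ae_eq (transform_ae hα hφ).symm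
  have hg := integrable_L2_mul (memLp_dilate hm hσ) hT
  have h := eLpNorm_comp_measurePreserving (p := 2)
    (continuous_transformL1 hα hg).aestronglyMeasurable (measurePreserving_refl d α)
  rw [eLpNorm_transformL1 hα hg] at h
  rw [multiplier, invTransform_of_integrable hg]
  refine (congrArg (· ^ 2) h).trans ?_
  simp only [eLpNorm_two_sq, enorm_mul, mul_pow]

/-- Plancherel's formula for multiplier operators with an admissible symbol. -/
lemma lintegral_enorm_sq_eq_lintegral_multiplier (hα : -(1 / 2) < α) {m : Pt d → ℂ}
    (hm : MemLp m 2 (mu d α)) (hadm : Admissible α m) {φ : Pt d → ℂ} (hφ : MemLp φ 2 (mu d α)) :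
    ∫⁻ x, ‖φ x‖ₑ ^ 2 ∂(mu d α) =
      ∫⁻ σ, eLpNorm (multiplier α m σ φ) 2 (mu d α) ^ 2 ∂scaleMeasure := by
  have hT := transform_ae hα hφ
  have hTm : MemLp (transform α φ) 2 (mu d α) := (Lp.memLp _).ae_eq hT.symm
  have h1 : ∫⁻ σ, eLpNorm (multiplier α m σ φ) 2 (mu d α) ^ 2 ∂scaleMeasure =
      ∫⁻ σ, ∫⁻ x, ‖dilate m σ x‖ₑ ^ 2 * ‖transform α φ x‖ₑ ^ 2 ∂(mu d α) ∂scaleMeasure :=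
    lintegral_congr_ae (ae_scaleMeasure_pos.mono fun σ hσ => eLpNorm_multiplier_sq hα hm hφ hσ)
  rw [h1, lintegral_lintegral_dilate_sq_mul hm.aestronglyMeasurable hadm
    (hTm.aestronglyMeasurable.enorm.pow_const 2) (fun x => by finiteness),
    ← eLpNorm_two_sq, ← eLpNorm_two_sq, eLpNorm_congr_ae hT, ← eLpNorm_congr_ae hφ.coeFn_toLp]
  congr 1
  rw [← ENNReal.toReal_eq_toReal_iff' (Lp.eLpNorm_ne_top _) (Lp.eLpNorm_ne_top _),
    ← Lp.norm_def, ← Lp.norm_def, LinearIsometryEquiv.norm_map]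

lemma memLp_two_of_integrable_of_bound {f : Pt d → ℂ} (hf : Integrable f (mu d α)) {C : ℝ}
    (hC : ∀ x, ‖f x‖ ≤ C) : MemLp f 2 (mu d α) := by
  rw [memLp_two_iff_integrable_sq_norm hf.aestronglyMeasurable]
  simp_rw [pow_two]
  exact hf.norm.mul_bdd (c := C) hf.aestronglyMeasurable.norm
    (Eventually.of_forall fun x => by rw [norm_norm]; exact hC x)

/-- The convolutions in Calderón's formula as inverse transforms. -/
lemma convExistsAt_and_conv_eq (hα : -(1 / 2) < α) {m : Pt d → ℂ} (hm : MemLp m 2 (mu d α))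
    {φ : Pt d → ℂ} (h1 : MemLp φ 1 (mu d α)) (hF : MemLp (transform α φ) 1 (mu d α))
    {σ : ℝ} (hσ : 0 < σ) (x : Pt d) :
    ConvExistsAt α (multiplier α m σ φ) (invTransform α fun y => conj (dilate m σ y)) x ∧
    conv α (multiplier α m σ φ) (invTransform α fun y => conj (dilate m σ y)) x =
      ∫ l, ((‖dilate m σ l‖ ^ 2 : ℝ) : ℂ) * (transformL1 α φ l * kernel α (refl x) l)
        ∂(mu d α) := by
  have hφ := memLp_one_iff_integrable.1 h1
  have hTr : transform α φ = transformL1 α φ := if_pos h1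
  rw [hTr, memLp_one_iff_integrable] at hF
  have hmσ := memLp_dilate hm hσ
  have hb : MemLp (fun y => conj (dilate m σ y)) 2 (mu d α) := hmσ.star
  have hbound := norm_transformL1_le hα hφ
  have hH2 := memLp_two_of_integrable_of_bound hF hbound
  let g : Pt d → ℂ := fun y => dilate m σ y * transformL1 α φ y
  have hg : Integrable g (mu d α) := integrable_L2_mul hmσ hH2
  -- Boundedness of the transform of $\varphi$ puts $g$ in $L^2$, in addition to $L^1$.
  have hg2 : MemLp g 2 (mu d α) := hmσ.of_le_mul (c := ∫ x, ‖φ x‖ ∂(mu d α))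
    hg.aestronglyMeasurable (Eventually.of_forall fun y => by
      rw [norm_mul, mul_comm]
      exact mul_le_mul_of_nonneg_right (hbound y) (norm_nonneg _))
  let a : Pt d → ℂ := fun l => g l * kernel α (refl x) l
  have ha : Integrable a (mu d α) := integrable_mul_kernel hα hg (refl x)
  have ha2 : MemLp a 2 (mu d α) :=
    hg2.mono ha.aestronglyMeasurable (Eventually.of_forall (norm_mul_kernel_le hα g (refl x)))
  have hmul : multiplier α m σ φ = fun l => transformL1 α g (refl l) := by
    rw [multiplier, hTr]
    exact invTransform_of_integrable hg
  have htr : ∀ y, translate α x (multiplier α m σ φ) (refl y) = transformL1 α a y := fun y => by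
    rw [hmul]
    exact translate_transformL1_refl hα hg x y
  have hA := transformL2_ae hα ha ha2
  rw [← plancherel_apply] at hA
  have hB := invTransform_ae hα hb
  have hB2 : MemLp (invTransform α fun y => conj (dilate m σ y)) 2 (mu d α) :=
    (Lp.memLp _).ae_eq hB.symm
  unfold ConvExistsAt conv
  simp_rw [htr]
  refine ⟨integrable_L2_mul (memLp_transformL1 hα ha ha2) hB2, ?_⟩
  -- The $L^2$ multiplication formula cancels the transform on $a$ against the inverse transform on
  -- $\overline{m_\sigma}$.
  have hM := integral_plancherel_mul hα (ha2.toLp a) ((plancherel d α).symm (hb.toLp _))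
  rw [LinearIsometryEquiv.apply_symm_apply] at hM
  refine Eq.trans (integral_congr_ae ?_) (hM.trans (integral_congr_ae ?_))
  · filter_upwards [hA, hB] with y hy hy'
    rw [hy, hy']
  · filter_upwards [ha2.coeFn_toLp, hb.coeFn_toLp] with y hy hy'
    rw [hy, hy']
    simp only [a, g]
    rw [Complex.ofReal_pow, ← Complex.mul_conj']
    ring

lemma integrable_prod_dilate_sq_mul {m : Pt d → ℂ} (hm : AEStronglyMeasurable m (mu d α))
    (hadm : Admissible α m) {f : Pt d → ℂ} (hf : Integrable f (mu d α)) :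
    Integrable (fun p : ℝ × Pt d => ((‖dilate m p.1 p.2‖ ^ 2 : ℝ) : ℂ) * f p.2)
      (scaleMeasure.prod (mu d α)) := by
  have hms : AEStronglyMeasurable (fun p : ℝ × Pt d => ((‖dilate m p.1 p.2‖ ^ 2 : ℝ) : ℂ) * f p.2)
      (scaleMeasure.prod (mu d α)) :=
    (Complex.continuous_ofReal.comp_aestronglyMeasurable
      ((aestronglyMeasurable_dilate hm).norm.pow 2)).mul hf.aestronglyMeasurable.comp_snd
  refine ⟨hms, ?_⟩
  have he : ∀ (σ : ℝ) (x : Pt d), ‖((‖dilate m σ x‖ ^ 2 : ℝ) : ℂ) * f x‖ₑ =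
      ‖dilate m σ x‖ₑ ^ 2 * ‖f x‖ₑ := fun σ x => by
    rw [enorm_mul, Complex.ofReal_pow, enorm_pow, ← ofReal_norm, Complex.norm_real, norm_norm,
      ofReal_norm]
  rw [HasFiniteIntegral, lintegral_prod _ hms.enorm]
  simp_rw [he]
  rw [lintegral_lintegral_dilate_sq_mul hm hadm hf.aestronglyMeasurable.enorm
    (fun x => by finiteness)]
  exact hf.2

lemma integral_dilate_sq {m : Pt d → ℂ} (hm : AEStronglyMeasurable m (mu d α))
    (hadm : Admissible α m) :
    ∀ᵐ x ∂(mu d α), ∫ σ, ‖dilate m σ x‖ ^ 2 ∂scaleMeasure = 1 := by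
  filter_upwards [hadm, (aestronglyMeasurable_dilate hm).prod_swap.prodMk_left] with x hx hx'
  have hx' : AEStronglyMeasurable (fun σ => dilate m σ x) scaleMeasure := hx'
  rw [integral_eq_lintegral_of_nonneg_ae (Eventually.of_forall fun σ => sq_nonneg _)
    (hx'.norm.pow 2)]
  simp_rw [ENNReal.ofReal_pow (norm_nonneg _), ofReal_norm, hx]
  simp

/-- Integrating out the scale in an admissible symbol. -/
lemma integral_integral_dilate_sq_mul {m : Pt d → ℂ} (hm : AEStronglyMeasurable m (mu d α))
    (hadm : Admissible α m) {f : Pt d → ℂ} (hf : Integrable f (mu d α)) :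
    ∫ σ, ∫ l, ((‖dilate m σ l‖ ^ 2 : ℝ) : ℂ) * f l ∂(mu d α) ∂scaleMeasure =
      ∫ l, f l ∂(mu d α) := by
  rw [integral_integral_swap (integrable_prod_dilate_sq_mul hm hadm hf)]
  refine integral_congr_ae ?_
  filter_upwards [integral_dilate_sq hm hadm] with l hl
  rw [integral_mul_const, integral_complex_ofReal, hl, Complex.ofReal_one, one_mul]

/-- Calderón's reproducing formula. -/
lemma calderon_formula (hα : -(1 / 2) < α) {m : Pt d → ℂ} (hm : MemLp m 2 (mu d α))
    (hadm : Admissible α m) {φ : Pt d → ℂ} (h1 : MemLp φ 1 (mu d α))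
    (hF : MemLp (transform α φ) 1 (mu d α)) :
    ∀ᵐ x ∂(mu d α),
      (∀ σ : ℝ, 0 < σ → ConvExistsAt α (multiplier α m σ φ)
        (invTransform α fun y => conj (dilate m σ y)) x) ∧
      Integrable (fun σ => conv α (multiplier α m σ φ)
        (invTransform α fun y => conj (dilate m σ y)) x) scaleMeasure ∧
      φ x = ∫ σ, conv α (multiplier α m σ φ)
        (invTransform α fun y => conj (dilate m σ y)) x ∂scaleMeasure := by
  have hφ := memLp_one_iff_integrable.1 h1
  have hTr : transform α φ = transformL1 α φ := if_pos h1
  have hH : Integrable (transformL1 α φ) (mu d α) := memLp_one_iff_integrable.1 (hTr ▸ hF)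
  -- Inversion is the only source of an exceptional null set: the convolution identity holds at
  -- every $x$ and every $\sigma>0$.
  filter_upwards [transformL1_transformL1_refl_ae hα hφ hH] with x hx
  have hf := integrable_mul_kernel hα hH (refl x)
  have hconv : (fun σ => conv α (multiplier α m σ φ)
      (invTransform α fun y => conj (dilate m σ y)) x) =ᵐ[scaleMeasure] fun σ =>
      ∫ l, ((‖dilate m σ l‖ ^ 2 : ℝ) : ℂ) * (transformL1 α φ l * kernel α (refl x) l)
        ∂(mu d α) :=
    ae_scaleMeasure_pos.mono fun σ hσ => (convExistsAt_and_conv_eq hα hm h1 hF hσ x).2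
  refine ⟨fun σ hσ => (convExistsAt_and_conv_eq hα hm h1 hF hσ x).1, ?_, ?_⟩
  · exact (integrable_prod_dilate_sq_mul hm.aestronglyMeasurable hadm hf).integral_prod_left.congr
      hconv.symm
  · rw [integral_congr_ae hconv,
      integral_integral_dilate_sq_mul hm.aestronglyMeasurable hadm hf, ← hx]
    rfl

end Calderon

end Weinstein

end

theorem theorem2p3 (d : ℕ) (α : ℝ) (hα : -(1 / 2) < α)
    (m : Weinstein.Pt d → ℂ) (hm : MemLp m 2 (Weinstein.mu d α))
    (hadm : Weinstein.Admissible α m) :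
    (∀ φ : Weinstein.Pt d → ℂ, MemLp φ 2 (Weinstein.mu d α) →
      ∫⁻ x, ‖φ x‖ₑ ^ 2 ∂(Weinstein.mu d α) =
        ∫⁻ σ, eLpNorm (Weinstein.multiplier α m σ φ) 2 (Weinstein.mu d α) ^ 2
          ∂Weinstein.scaleMeasure) ∧
    (∀ φ : Weinstein.Pt d → ℂ, MemLp φ 1 (Weinstein.mu d α) →
      MemLp (Weinstein.transform α φ) 1 (Weinstein.mu d α) →
      ∀ᵐ x ∂(Weinstein.mu d α),
        (∀ σ : ℝ, 0 < σ → Weinstein.ConvExistsAt α (Weinstein.multiplier α m σ φ)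
          (Weinstein.invTransform α fun y => conj (Weinstein.dilate m σ y)) x) ∧
        Integrable (fun σ => Weinstein.conv α (Weinstein.multiplier α m σ φ)
          (Weinstein.invTransform α fun y => conj (Weinstein.dilate m σ y)) x)
          Weinstein.scaleMeasure ∧
        φ x = ∫ σ, Weinstein.conv α (Weinstein.multiplier α m σ φ)
          (Weinstein.invTransform α fun y => conj (Weinstein.dilate m σ y)) x
          ∂Weinstein.scaleMeasure) :=
  ⟨fun _ hφ => Weinstein.lintegral_enorm_sq_eq_lintegral_multiplier hα hm hadm hφ,
    fun _ h1 hF => Weinstein.calderon_formula hα hm hadm h1 hF⟩
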